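/- Let $\check{\mathcal C}$ be a spin modular category: a unitary modular tensor category with a preferred fermion $\psi$, i.e. $\psi\neq 1$, $\psi\times\psi=1$, $\theta_\psi=-1$. Write $M_{a,\psi}=\pm1$ for the double braid of a simple object $a$ with $\psi$. Let $\mathcal C$ be the full subcategory of $\check{\mathcal C}$ on the simple objects with $M_{a,\psi}=+1$ (a super-modular category, of which $\check{\mathcal C}$ is a minimal modular extension). A simple object $x$ with $M_{x,\psi}=-1$ is called a (fermion) parity vortex; it is $v$-type if $x\times\psi\neq x$ and $\sigma$-type if $x\times\psi=x$. For $\mathcal B\in\{\check{\mathcal C},\mathcal C\}$, a braided autoequivalence $\rho$ of $\mathcal B$ consists of a permutation of the simple objects and unitary matrices $U$ with $\rho|a,b;c;\mu\rangle=\sum_\nu U(\rho a,\rho b;\rho c)_{\mu\nu}|\rho a,\rho b;\rho c;\nu\rangle$ on the basis vectors of the splitting spaces $V^{ab}_c$, extended linearly (or antilinearly, for anti-autoequivalences), which preserves the $F$- and $R$-symbols (up to complex conjugation in the antilinear case). Let $\mathrm{Aut}_{LR}(\mathcal B)$ be the group of those with $\rho|\psi,\psi;1\rangle=|\psi,\psi;1\rangle$,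 modulo the locality-respecting natural isomorphisms, i.e. the linear ones which fix all simple objects and act by $|a,b;c;\mu\rangle\mapsto\frac{\gamma_a\gamma_b}{\gamma_c}|a,b;c;\mu\rangle$ with $\gamma_a\in U(1)$ and $\gamma_\psi=1$. Let $r:\mathrm{Aut}_{LR}(\check{\mathcal C})\to\mathrm{Aut}_{LR}(\mathcal C)$ be restriction. Suppose that the block of the modular $S$-matrix of $\check{\mathcal C}$ with rows and columns indexed by the $v$-type vortices is block diagonal with exactly $k$ decoupled blocks: the set of $v$-type vortices is partitioned into $k\ge 0$ non-empty classes such that $S_{x,y}=0$ for $x,y$ in different classes, and no class can be split further into two non-empty parts between which $S$ vanishes. Then for every $[\rho]\in\ker r$ there is a function $q$ from the parity vortices to $\{0,1\}$ such that $\rho(x)=x\times\psi^{q(x)}$ for every parity vortex $x$, $q$ is constant on each of the $k$ classes of $v$-type vortices, and $q(x)=0$ for every $\sigma$-type vortex $x$. -/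

import Mathlib

open scoped Kronecker
open Matrix

noncomputable section

/-- The basis `|a,b;c;μ⟩`, `μ < N a b c`, of all the splitting spaces `V^{ab}_c` together,
indexed by the label triple `(a, b, c)` and the multiplicity index `μ`. -/
abbrev Vertex {L : Type*} (N : L → L → L → ℕ) : Type _ :=
  Σ t : L × L × L, Fin (N t.1 t.2.1 t.2.2)

namespace Vertex

variable {L : Type*} {N : L → L → L → ℕ}

/-- The label `a` of `|a,b;c;μ⟩`. -/
abbrev a (v : Vertex N) : L := v.1.1

/-- The label `b` of `|a,b;c;μ⟩`. -/
abbrev b (v : Vertex N) : L := v.1.2.1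

/-- The label `c` of `|a,b;c;μ⟩`. -/
abbrev c (v : Vertex N) : L := v.1.2.2

end Vertex

/-- Skeletal data of a braided fusion category with set `L` of anyon labels: fusion coefficients
`N a b c = N_{ab}^c`, the vacuum label, and the `F`- and `R`-symbols.

All `F`-symbols are collected in one matrix: the row `(u, v)` stands for the fusion tree
`u = |a,b;e;α⟩`, `v = |e,c;d;β⟩`, the column `(p, q)` for the tree `p = |b,c;f;μ⟩`,
`q = |a,f;d;ν⟩`, and the entry is `[F^{abc}_d]_{(e,α,β),(f,μ,ν)}`.
All `R`-symbols are collected in one matrix: the entry in row `|b,a;c;μ⟩` and column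
`|a,b;c;ν⟩` is `[R^{ab}_c]_{μν}`. Entries at indices that are not of this shape are required to
vanish in `IsUBFC`. -/
structure BraidedFusionData (L : Type*) where
  N : L → L → L → ℕ
  one : L
  F : Matrix (Vertex N × Vertex N) (Vertex N × Vertex N) ℂ
  R : Matrix (Vertex N) (Vertex N) ℂ

namespace BraidedFusionData

section Data

variable {L : Type*} [Fintype L] [DecidableEq L] (D : BraidedFusionData L)

/-- The axioms of a unitary braided fusion category, in skeletal form. -/
structure IsUBFC : Prop where
  one_fusion : ∀ a b, D.N D.one a b = if b = a then 1 else 0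
  fusion_one : ∀ a b, D.N a D.one b = if b = a then 1 else 0
  /-- Every label has exactly one dual. -/
  dual : ∀ a, ∃ a', ∀ b, D.N a b D.one = if b = a' then 1 else 0
  F_support : ∀ u v p q, D.F (u, v) (p, q) ≠ 0 →
    u.c = v.a ∧ p.c = q.b ∧
      u.a = q.a ∧ u.b = p.a ∧ v.b = p.b ∧ v.c = q.c
  /-- `F` is unitary from right trees to left trees (two conditions). -/
  F_mul_star : D.F * D.Fᴴ = Matrix.diagonal fun x => if x.1.c = x.2.a then 1 else 0
  star_mul_F : D.Fᴴ * D.F = Matrix.diagonal fun x => if x.1.c = x.2.b then 1 else 0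
  pentagon : ∀ u v w x y z,
    ∑ t, D.F (v, w) (x, t) * D.F (u, t) (y, z) =
      ∑ p, ∑ r, ∑ s, D.F (u, v) (p, r) * D.F (r, w) (s, z) * D.F (p, s) (x, y)
  /-- `F^{a1b}_c` is the identity. -/
  triangle : ∀ u v p q, u.c = v.a → u.b = D.one → p.c = q.b → p.a = D.one →
    D.F (u, v) (p, q) = if v = q then 1 else 0
  /-- Rigidity: `[F^{a a' a}_a]_{1,1} ≠ 0` for the dual `a'` of `a`. -/
  rigid : ∀ u v p q, u.c = D.one → v.a = D.one → p.c = D.one → q.b = D.one →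
    u.a = q.a → u.b = p.a → v.b = p.b → v.c = q.c → D.F (u, v) (p, q) ≠ 0
  R_support : ∀ u v, D.R u v ≠ 0 → u.a = v.b ∧ u.b = v.a ∧ u.c = v.c
  R_unitary : D.R ∈ Matrix.unitaryGroup (Vertex D.N) ℂ
  hexagon : (D.R ⊗ₖ 1) * D.F * (D.R ⊗ₖ 1) = D.F * (1 ⊗ₖ D.R) * D.F
  hexagon_inv : (D.Rᴴ ⊗ₖ 1) * D.F * (D.Rᴴ ⊗ₖ 1) = D.F * (1 ⊗ₖ D.Rᴴ) * D.F

/-- The quantum dimension `d_a`: the largest modulus of an eigenvalue of the fusion matrix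
`(N_{ab}^c)_{b,c}`. -/
def qdim (a : L) : ℝ :=
  (spectralRadius ℂ (Matrix.of fun b c => (D.N a b c : ℂ))).toReal

/-- The total quantum dimension. -/
def totalDim : ℝ := √(∑ a, D.qdim a ^ 2)

/-- The topological twist `θ_a = ∑_c (d_c / d_a) tr R^{aa}_c`. -/
def twist (a : L) : ℂ :=
  ∑ i : Vertex D.N,
    if i.a = a ∧ i.b = a then ((D.qdim i.c / D.qdim a : ℝ) : ℂ) * D.R i i else 0

/-- The topological `S`-matrix, the normalized quantum trace of the double braid:
`S_{ab} = 𝒟⁻¹ ∑_c d_c tr (R^{ba}_c R^{ab}_c)`. -/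
def S : Matrix L L ℂ := Matrix.of fun a b =>
  (D.totalDim : ℂ)⁻¹ * ∑ i : Vertex D.N,
    if i.a = a ∧ i.b = b then (D.qdim i.c : ℂ) * (D.R * D.R) i i else 0

/-- A unitary modular tensor category. -/
structure IsUMTC : Prop extends D.IsUBFC where
  modular : IsUnit D.S

/-- `a × b = c`: the fusion product of `a` and `b` is the simple object `c`. -/
def FusesTo (a b c : L) : Prop := ∀ x, D.N a b x = if x = c then 1 else 0

/-- A spin modular category: a UMTC with a preferred fermion `ψ`, `ψ × ψ = 1`, `ψ ≠ 1`. -/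
structure IsSpinModular (ψ : L) : Prop extends D.IsUMTC where
  ne_one : ψ ≠ D.one
  fuse : D.FusesTo ψ ψ D.one
  fermion : D.twist ψ = -1

/-- `M_{a,ψ} = m`: the double braid of `a` around `ψ` is the scalar `m`. -/
def BraidsBy (ψ : L) (m : ℂ) (a : L) : Prop :=
  ∀ i j : Vertex D.N, i.a = a → i.b = ψ → (D.R * D.R) i j = if i = j then m else 0

open Classical in
/-- The even sector: the labels with `M_{a,ψ} = +1`. -/
def even (ψ : L) : Finset L := Finset.univ.filter (D.BraidsBy ψ 1)

/-- The odd sector, the fermion parity vortices: `M_{a,ψ} = -1`. -/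
def IsVortex (ψ a : L) : Prop := D.BraidsBy ψ (-1) a

/-- A `v`-type vortex: `a × ψ ≠ a`. -/
def IsVType (ψ a : L) : Prop := D.IsVortex ψ a ∧ ¬ D.FusesTo a ψ a

/-- A `σ`-type vortex: `a × ψ = a`. -/
def IsSigmaType (ψ a : L) : Prop := D.IsVortex ψ a ∧ D.FusesTo a ψ a

/-- The label `ψ ^ n` for `n ∈ {0, 1}`. -/
def psiPow (ψ : L) (n : Fin 2) : L := if n = 0 then D.one else ψ

/-- `B` is the decomposition of the `v`-type vortices into the `k` decoupled blocks of the
restricted `S`-matrix: no block is empty, entries of `S` between different blocks vanish, and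
no block can be decoupled further. -/
structure IsBlockDecomposition (ψ : L) {k : ℕ} (B : {x : L // D.IsVType ψ x} → Fin k) : Prop where
  surjective : Function.Surjective B
  decoupled : ∀ x y, B x ≠ B y → D.S x y = 0
  indecomposable : ∀ T : Set {x : L // D.IsVType ψ x},
    (∀ x ∈ T, ∀ y ∉ T, B x = B y → D.S x y = 0 ∧ D.S y x = 0) →
      ∀ x y, B x = B y → x ∈ T → y ∈ T

/-- Braided autoequivalences and anti-autoequivalences:
`ρ |a,b;c;μ⟩ = ∑_ν U(ρa,ρb;ρc)_{μν} |ρa,ρb;ρc;ν⟩`, extended linearly if `σ = 1` and antilinearly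
if `σ` is complex conjugation. The entry of `U` in row `|a,b;c;μ⟩` and column `|ρa,ρb;ρc;ν⟩` is
`U(ρa,ρb;ρc)_{μν}`. -/
@[ext]
structure Autoequiv where
  σ : ℂ ≃ₐ[ℝ] ℂ
  perm : Equiv.Perm L
  U : Matrix (Vertex D.N) (Vertex D.N) ℂ
  U_support : ∀ i j, U i j ≠ 0 →
    j.a = perm i.a ∧ j.b = perm i.b ∧ j.c = perm i.c
  U_unitary : U ∈ Matrix.unitaryGroup (Vertex D.N) ℂ
  map_F : D.F.map σ = (U ⊗ₖ U) * D.F * (U ⊗ₖ U)ᴴ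
  map_R : D.R.map σ = U * D.R * Uᴴ

end Data

section Group

variable {L : Type*} [Fintype L] [DecidableEq L] {D : BraidedFusionData L}

theorem gal_star (σ : ℂ ≃ₐ[ℝ] ℂ) (z : ℂ) : σ (star z) = star (σ z) := by
  rcases Complex.real_algHom_eq_id_or_conj (σ : ℂ →ₐ[ℝ] ℂ) with h | h
  · have h' : ∀ w, σ w = w := fun w => by simpa using DFunLike.congr_fun h w
    simp [h']
  · have h' : ∀ w, σ w = star w := fun w => by simpa using DFunLike.congr_fun h w
    simp [h']

theorem map_conjTranspose {m n : Type*} (σ : ℂ ≃ₐ[ℝ] ℂ) (A : Matrix m n ℂ) :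
    Aᴴ.map σ = (A.map σ)ᴴ := by
  ext i j
  simp only [Matrix.map_apply, Matrix.conjTranspose_apply, gal_star]

theorem gal_map_mul {m n p : Type*} [Fintype n] (σ : ℂ ≃ₐ[ℝ] ℂ) (A : Matrix m n ℂ)
    (B : Matrix n p ℂ) : (A * B).map σ = A.map σ * B.map σ := by
  ext i j
  simp [Matrix.mul_apply]

theorem map_kron {m n p q : Type*} (σ : ℂ ≃ₐ[ℝ] ℂ) (A : Matrix m n ℂ) (B : Matrix p q ℂ) :
    (A ⊗ₖ B).map σ = A.map σ ⊗ₖ B.map σ := by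
  ext i j
  simp [Matrix.kroneckerMap_apply]

theorem gal_map_one {n : Type*} [DecidableEq n] (σ : ℂ ≃ₐ[ℝ] ℂ) :
    (1 : Matrix n n ℂ).map σ = 1 := by
  ext i j
  by_cases h : i = j <;> simp [Matrix.one_apply, h]

theorem map_unitary {n : Type*} [Fintype n] [DecidableEq n] (σ : ℂ ≃ₐ[ℝ] ℂ) {A : Matrix n n ℂ}
    (h : A ∈ Matrix.unitaryGroup n ℂ) : A.map σ ∈ Matrix.unitaryGroup n ℂ := by
  rw [Matrix.mem_unitaryGroup_iff] at h ⊢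
  rw [Matrix.star_eq_conjTranspose] at h ⊢
  rw [← map_conjTranspose, ← gal_map_mul, h, gal_map_one]

theorem unitary_mul {n : Type*} [Fintype n] [DecidableEq n] {A : Matrix n n ℂ}
    (h : A ∈ Matrix.unitaryGroup n ℂ) : A * Aᴴ = 1 := by
  simpa [Matrix.star_eq_conjTranspose] using Matrix.mem_unitaryGroup_iff.1 h

theorem unitary_mul' {n : Type*} [Fintype n] [DecidableEq n] {A : Matrix n n ℂ}
    (h : A ∈ Matrix.unitaryGroup n ℂ) : Aᴴ * A = 1 := by
  simpa [Matrix.star_eq_conjTranspose] using Matrix.mem_unitaryGroup_iff'.1 h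

theorem unitary_conjTranspose {n : Type*} [Fintype n] [DecidableEq n] {A : Matrix n n ℂ}
    (h : A ∈ Matrix.unitaryGroup n ℂ) : Aᴴ ∈ Matrix.unitaryGroup n ℂ := by
  rw [Matrix.mem_unitaryGroup_iff, Matrix.star_eq_conjTranspose, Matrix.conjTranspose_conjTranspose]
  exact unitary_mul' h

theorem kron_unitary {n : Type*} [Fintype n] [DecidableEq n] {A : Matrix n n ℂ}
    (h : A ∈ Matrix.unitaryGroup n ℂ) : A ⊗ₖ A ∈ Matrix.unitaryGroup (n × n) ℂ := by
  rw [Matrix.mem_unitaryGroup_iff, Matrix.star_eq_conjTranspose, Matrix.conjTranspose_kronecker,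
    ← Matrix.mul_kronecker_mul, unitary_mul h, Matrix.one_kronecker_one]

namespace Autoequiv

/-- Composition: `(ρ * τ) |i⟩ = ρ (τ |i⟩)`. -/
instance : Mul D.Autoequiv where
  mul ρ τ :=
    { σ := ρ.σ * τ.σ
      perm := ρ.perm * τ.perm
      U := τ.U.map ρ.σ * ρ.U
      U_support := by
        intro i j hij
        rw [Matrix.mul_apply] at hij
        obtain ⟨m, -, hm⟩ := Finset.exists_ne_zero_of_sum_ne_zero hij
        have h1 : τ.U i m ≠ 0 := by
          intro h; apply hm; simp [h]
        have h2 : ρ.U m j ≠ 0 := right_ne_zero_of_mul hm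
        obtain ⟨a1, a2, a3⟩ := τ.U_support _ _ h1
        obtain ⟨b1, b2, b3⟩ := ρ.U_support _ _ h2
        simp only [Equiv.Perm.mul_apply]
        rw [b1, b2, b3, a1, a2, a3]
        exact ⟨rfl, rfl, rfl⟩
      U_unitary := mul_mem (map_unitary _ τ.U_unitary) ρ.U_unitary
      map_F := by
        have h : D.F.map (ρ.σ * τ.σ : ℂ ≃ₐ[ℝ] ℂ) = (D.F.map τ.σ).map ρ.σ := by
          ext; simp
        rw [h, τ.map_F, gal_map_mul, gal_map_mul, map_conjTranspose, map_kron, ρ.map_F,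
          Matrix.mul_kronecker_mul, Matrix.conjTranspose_mul]
        simp only [Matrix.mul_assoc]
      map_R := by
        have h : D.R.map (ρ.σ * τ.σ : ℂ ≃ₐ[ℝ] ℂ) = (D.R.map τ.σ).map ρ.σ := by
          ext; simp
        rw [h, τ.map_R, gal_map_mul, gal_map_mul, map_conjTranspose, ρ.map_R,
          Matrix.conjTranspose_mul]
        simp only [Matrix.mul_assoc] }

/-- The identity. -/
instance : One D.Autoequiv where
  one :=
    { σ := 1
      perm := 1
      U := 1
      U_support := by
        intro i j hij
        have : i = j := by
          by_contra h; exact hij (Matrix.one_apply_ne h)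
        subst this
        exact ⟨rfl, rfl, rfl⟩
      U_unitary := one_mem _
      map_F := by
        ext; simp
      map_R := by
        ext; simp }

instance : Inv D.Autoequiv where
  inv ρ :=
    { σ := ρ.σ⁻¹
      perm := ρ.perm⁻¹
      U := ρ.Uᴴ.map (ρ.σ⁻¹ : ℂ ≃ₐ[ℝ] ℂ)
      U_support := by
        intro i j hij
        have h1 : ρ.U j i ≠ 0 := by
          intro h; apply hij; simp [h]
        obtain ⟨a1, a2, a3⟩ := ρ.U_support _ _ h1
        simp [a1, a2, a3]
      U_unitary := map_unitary _ (unitary_conjTranspose ρ.U_unitary)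
      map_F := by
        have h := ρ.map_F
        have hU := unitary_mul' (kron_unitary ρ.U_unitary)
        have h2 : D.F = (ρ.U ⊗ₖ ρ.U)ᴴ * D.F.map ρ.σ * (ρ.U ⊗ₖ ρ.U) := by
          rw [h]
          calc D.F = 1 * D.F * 1 := by simp
            _ = _ := by rw [← hU]; simp only [Matrix.mul_assoc]
        have h3 : (D.F.map ρ.σ).map (ρ.σ⁻¹ : ℂ ≃ₐ[ℝ] ℂ) = D.F := by
          ext i j
          change (ρ.σ⁻¹ * ρ.σ) (D.F i j) = _
          simp
        conv_lhs => rw [h2]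
        rw [gal_map_mul, gal_map_mul, h3, ← map_kron, ← Matrix.conjTranspose_kronecker,
          ← map_conjTranspose, Matrix.conjTranspose_conjTranspose]
      map_R := by
        have h := ρ.map_R
        have hU := unitary_mul' ρ.U_unitary
        have h2 : D.R = ρ.Uᴴ * D.R.map ρ.σ * ρ.U := by
          rw [h]
          calc D.R = 1 * D.R * 1 := by simp
            _ = _ := by rw [← hU]; simp only [Matrix.mul_assoc]
        have h3 : (D.R.map ρ.σ).map (ρ.σ⁻¹ : ℂ ≃ₐ[ℝ] ℂ) = D.R := by
          ext i j
          change (ρ.σ⁻¹ * ρ.σ) (D.R i j) = _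
          simp
        conv_lhs => rw [h2]
        rw [gal_map_mul, gal_map_mul, h3, ← map_conjTranspose, Matrix.conjTranspose_conjTranspose] }

theorem mul_σ (ρ τ : D.Autoequiv) : (ρ * τ).σ = ρ.σ * τ.σ := rfl
theorem mul_perm (ρ τ : D.Autoequiv) : (ρ * τ).perm = ρ.perm * τ.perm := rfl
theorem mul_U (ρ τ : D.Autoequiv) : (ρ * τ).U = τ.U.map ρ.σ * ρ.U := rfl
theorem one_σ : (1 : D.Autoequiv).σ = 1 := rfl
theorem one_perm : (1 : D.Autoequiv).perm = 1 := rfl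
theorem one_U : (1 : D.Autoequiv).U = 1 := rfl
theorem inv_σ (ρ : D.Autoequiv) : ρ⁻¹.σ = ρ.σ⁻¹ := rfl
theorem inv_perm (ρ : D.Autoequiv) : ρ⁻¹.perm = ρ.perm⁻¹ := rfl
theorem inv_U (ρ : D.Autoequiv) : ρ⁻¹.U = ρ.Uᴴ.map (ρ.σ⁻¹ : ℂ ≃ₐ[ℝ] ℂ) := rfl

instance : Group D.Autoequiv :=
  Group.ofLeftAxioms
    (by
      intro a b c
      apply Autoequiv.ext
      · simp only [mul_σ, mul_assoc]
      · simp only [mul_perm, mul_assoc]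
      · simp only [mul_U, mul_σ, gal_map_mul, Matrix.mul_assoc]
        congr 1)
    (by
      intro a
      apply Autoequiv.ext
      · simp only [mul_σ, one_σ, one_mul]
      · simp only [mul_perm, one_perm, one_mul]
      · simp only [mul_U, one_U, one_σ, Matrix.mul_one]
        ext; simp)
    (by
      intro a
      apply Autoequiv.ext
      · simp only [mul_σ, one_σ, inv_σ, inv_mul_cancel]
      · simp only [mul_perm, one_perm, inv_perm, inv_mul_cancel]
      · simp only [mul_U, one_U, inv_σ, inv_U]
        rw [← gal_map_mul, unitary_mul a.U_unitary, gal_map_one])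

end Autoequiv

/-- The autoequivalences that fix `ψ` and `|ψ,ψ;1⟩`, i.e. have `U(ψ,ψ;1) = +1`. -/
def lrRep (D : BraidedFusionData L) (ψ : L) : Subgroup D.Autoequiv where
  carrier := {ρ | ρ.perm ψ = ψ ∧
    ∀ i : Vertex D.N, i.a = ψ → i.b = ψ → i.c = D.one →
      ∀ j, ρ.U i j = if i = j then 1 else 0}
  mul_mem' := by
    rintro ρ τ ⟨h1, h2⟩ ⟨h3, h4⟩
    refine ⟨by rw [Autoequiv.mul_perm, Equiv.Perm.mul_apply, h3, h1], ?_⟩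
    intro i ha hb hc j
    rw [Autoequiv.mul_U, Matrix.mul_apply, Finset.sum_eq_single i]
    · simp [h4 i ha hb hc, h2 i ha hb hc]
    · intro m _ hm
      simp [h4 i ha hb hc, Ne.symm hm]
    · simp
  one_mem' := ⟨rfl, fun i _ _ _ j => Matrix.one_apply⟩
  inv_mem' := by
    rintro ρ ⟨h1, h2⟩
    refine ⟨by rw [Autoequiv.inv_perm, Equiv.Perm.inv_eq_iff_eq, h1], ?_⟩
    intro i ha hb hc j
    have h3 : (ρ.U * ρ.Uᴴ) i j = (1 : Matrix _ _ ℂ) i j := by rw [unitary_mul ρ.U_unitary]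
    rw [Matrix.mul_apply, Finset.sum_eq_single i, Matrix.one_apply, h2 i ha hb hc i] at h3
    · simp only [if_true, one_mul] at h3
      rw [Autoequiv.inv_U, Matrix.map_apply, h3]
      split_ifs <;> simp
    · intro m _ hm
      simp [h2 i ha hb hc, Ne.symm hm]
    · simp

/-- The phases `γ_a γ_b / γ_c` by which a natural isomorphism acts on `|a,b;c;μ⟩`. -/
def natPhase {N : L → L → L → ℕ} (γ : L → Circle) (i : Vertex N) : ℂ :=
  ((γ i.a * γ i.b / γ i.c : Circle) : ℂ)

/-- The locality-respecting natural isomorphisms: `γ_ψ = +1`. -/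
def lrNatIso (D : BraidedFusionData L) (ψ : L) : Subgroup (lrRep D ψ) where
  carrier := {ρ | ρ.1.σ = 1 ∧ ρ.1.perm = 1 ∧
    ∃ γ : L → Circle, γ ψ = 1 ∧ ρ.1.U = Matrix.diagonal (natPhase γ)}
  mul_mem' := by
    rintro ρ τ ⟨h1, h2, γ, h3, h4⟩ ⟨k1, k2, δ, k3, k4⟩
    refine ⟨by simp [Autoequiv.mul_σ, h1, k1], by simp [Autoequiv.mul_perm, h2, k2],
      fun a => γ a * δ a, by simp [h3, k3], ?_⟩
    rw [Subgroup.coe_mul, Autoequiv.mul_U, h1, h4, k4]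
    have : (Matrix.diagonal (natPhase (N := D.N) δ)).map (1 : ℂ ≃ₐ[ℝ] ℂ)
        = Matrix.diagonal (natPhase δ) := by ext; simp
    rw [this, Matrix.diagonal_mul_diagonal]
    congr 1
    ext i
    simp only [natPhase, ← Circle.coe_mul]
    congr 1
    rw [div_mul_div_comm]
    congr 1
    exact (mul_mul_mul_comm _ _ _ _).trans (by ac_rfl)
    exact mul_comm _ _
  one_mem' := ⟨rfl, rfl, 1, rfl, by
    have : natPhase (N := D.N) (1 : L → Circle) = fun _ => 1 := by
      ext i; simp [natPhase]
    rw [this, Matrix.diagonal_one]; rfl⟩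
  inv_mem' := by
    rintro ρ ⟨h1, h2, γ, h3, h4⟩
    refine ⟨by simp [Autoequiv.inv_σ, h1], by simp [Autoequiv.inv_perm, h2], fun a => (γ a)⁻¹,
      by simp [h3], ?_⟩
    rw [Subgroup.coe_inv, Autoequiv.inv_U, h1, h4, Matrix.diagonal_conjTranspose]
    ext i j
    by_cases hij : i = j
    · subst hij
      simp [natPhase, ← Circle.coe_inv_eq_conj, div_eq_mul_inv]
    · simp [hij]

theorem lrNatIso_conj_aux (ρ : D.Autoequiv) (γ : L → Circle) :
    (ρ.U * Matrix.diagonal (natPhase γ)) =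
      Matrix.diagonal (natPhase fun a => γ (ρ.perm a)) * ρ.U := by
  ext i j
  rw [Matrix.mul_diagonal, Matrix.diagonal_mul]
  by_cases h : ρ.U i j = 0
  · simp [h]
  · obtain ⟨a1, a2, a3⟩ := ρ.U_support _ _ h
    simp only [natPhase]
    rw [a1, a2, a3, mul_comm]

theorem gal_circle (σ : ℂ ≃ₐ[ℝ] ℂ) : ∃ f : Circle →* Circle, ∀ z : Circle, σ z = f z := by
  rcases Complex.real_algHom_eq_id_or_conj (σ : ℂ →ₐ[ℝ] ℂ) with h | h
  · exact ⟨MonoidHom.id _, fun z => by simpa using DFunLike.congr_fun h (z : ℂ)⟩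
  · refine ⟨invMonoidHom, fun z => ?_⟩
    have := DFunLike.congr_fun h (z : ℂ)
    rw [invMonoidHom_apply, Circle.coe_inv_eq_conj]
    simpa using this

instance lrNatIso_normal (D : BraidedFusionData L) (ψ : L) : (lrNatIso D ψ).Normal where
  conj_mem := by
    rintro ν ⟨h1, h2, γ, h3, h4⟩ ρ
    obtain ⟨f, hf⟩ := gal_circle ρ.1.σ
    have hψ : ρ.1.perm.symm ψ = ψ := by rw [Equiv.symm_apply_eq, ρ.2.1]
    refine ⟨by simp [Autoequiv.mul_σ, Autoequiv.inv_σ, h1],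
      by simp [Autoequiv.mul_perm, Autoequiv.inv_perm, h2],
      fun a => f (γ (ρ.1.perm.symm a)), by simp [hψ, h3], ?_⟩
    have key := lrNatIso_conj_aux ρ.1 (fun a => f (γ (ρ.1.perm.symm a)))
    have hm : (Matrix.diagonal (natPhase (N := D.N) γ)).map ρ.1.σ =
        Matrix.diagonal (natPhase fun a => f (γ a)) := by
      ext i j
      by_cases hij : i = j
      · subst hij
        simp [natPhase, hf]
      · simp [hij]
    have hi : (ρ.1.Uᴴ.map (ρ.1.σ⁻¹ : ℂ ≃ₐ[ℝ] ℂ)).map ρ.1.σ = ρ.1.Uᴴ := by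
      ext i j
      change (ρ.1.σ * ρ.1.σ⁻¹) (ρ.1.Uᴴ i j) = _
      simp
    rw [Subgroup.coe_mul, Subgroup.coe_mul, Subgroup.coe_inv, Autoequiv.mul_U, Autoequiv.mul_σ, h1,
      mul_one, Autoequiv.inv_U, hi, Autoequiv.mul_U, h4, hm]
    simp only [Equiv.symm_apply_apply] at key
    rw [← key, ← Matrix.mul_assoc, unitary_mul' ρ.1.U_unitary, Matrix.one_mul]

/-- `Aut_LR`: autoequivalences with `U(ψ,ψ;1) = +1`, modulo locality-respecting natural
isomorphisms. -/
abbrev AutLR (D : BraidedFusionData L) (ψ : L) : Type _ := lrRep D ψ ⧸ lrNatIso D ψ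

/-- The permutation of the anyon labels by an element of `Aut_LR`. -/
def AutLR.perm (D : BraidedFusionData L) (ψ : L) : AutLR D ψ →* Equiv.Perm L :=
  QuotientGroup.lift (lrNatIso D ψ)
    { toFun := fun ρ => ρ.1.perm, map_one' := rfl, map_mul' := fun _ _ => rfl }
    (fun _ h => h.2.1)

end Group

section Restrict

set_option linter.unusedSectionVars false

variable {L : Type*} [Fintype L] [DecidableEq L] (D : BraidedFusionData L)

/-- The vertices of a subset of the labels, among all vertices. -/
def inclVertex (N : L → L → L → ℕ) (C : Finset L) (v : Vertex fun a b c : C => N a b c) :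
    Vertex N :=
  ⟨(v.1.1, v.1.2.1, v.1.2.2), v.2⟩

theorem inclVertex_injective (N : L → L → L → ℕ) (C : Finset L) :
    Function.Injective (inclVertex N C) := by
  rintro ⟨⟨⟨a, ha⟩, ⟨b, hb⟩, ⟨c, hc⟩⟩, m⟩ ⟨⟨⟨a', ha'⟩, ⟨b', hb'⟩, ⟨c', hc'⟩⟩, m'⟩ h
  simp only [inclVertex, Sigma.mk.injEq, Prod.mk.injEq] at h
  obtain ⟨⟨rfl, rfl, rfl⟩, h⟩ := h
  simpa using h

theorem mem_range_inclVertex {N : L → L → L → ℕ} {C : Finset L} {v : Vertex N}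
    (h1 : v.a ∈ C) (h2 : v.b ∈ C) (h3 : v.c ∈ C) : v ∈ Set.range (inclVertex N C) :=
  ⟨⟨(⟨_, h1⟩, ⟨_, h2⟩, ⟨_, h3⟩), v.2⟩, rfl⟩

/-- The full subcategory on a set `C` of labels that contains the vacuum. -/
def sub (C : Finset L) (h : D.one ∈ C) : BraidedFusionData C where
  N a b c := D.N a b c
  one := ⟨D.one, h⟩
  F := D.F.submatrix (Prod.map (inclVertex D.N C) (inclVertex D.N C))
    (Prod.map (inclVertex D.N C) (inclVertex D.N C))
  R := D.R.submatrix (inclVertex D.N C) (inclVertex D.N C)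

theorem submatrix_mul_of_row {m n : Type*} [Fintype m] [Fintype n] {e : m → n}
    (he : Function.Injective e) {A B : Matrix n n ℂ}
    (h : ∀ i j, A (e i) j ≠ 0 → j ∈ Set.range e) :
    (A * B).submatrix e e = A.submatrix e e * B.submatrix e e := by
  ext i j
  simp only [Matrix.submatrix_apply, Matrix.mul_apply]
  symm
  refine Fintype.sum_of_injective e he _ _ (fun x hx => ?_) fun _ => rfl
  have : A (e i) x = 0 := by
    by_contra h'; exact hx (h _ _ h')
  simp [this]

theorem submatrix_mul_of_col {m n : Type*} [Fintype m] [Fintype n] {e : m → n}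
    (he : Function.Injective e) {A B : Matrix n n ℂ}
    (h : ∀ i j, B j (e i) ≠ 0 → j ∈ Set.range e) :
    (A * B).submatrix e e = A.submatrix e e * B.submatrix e e := by
  ext i j
  simp only [Matrix.submatrix_apply, Matrix.mul_apply]
  symm
  refine Fintype.sum_of_injective e he _ _ (fun x hx => ?_) fun _ => rfl
  have : B x (e j) = 0 := by
    by_contra h'; exact hx (h _ _ h')
  simp [this]

variable {D}

theorem Autoequiv.row_mem (ρ : D.Autoequiv) {C : Finset L} (hC : ∀ a, ρ.perm a ∈ C ↔ a ∈ C)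
    (i : Vertex fun a b c : C => D.N a b c) (j : Vertex D.N)
    (h : ρ.U (inclVertex D.N C i) j ≠ 0) : j ∈ Set.range (inclVertex D.N C) := by
  obtain ⟨a1, a2, a3⟩ := ρ.U_support _ _ h
  apply mem_range_inclVertex
  · rw [a1, hC]; exact i.1.1.2
  · rw [a2, hC]; exact i.1.2.1.2
  · rw [a3, hC]; exact i.1.2.2.2

theorem Autoequiv.row_mem₂ (ρ : D.Autoequiv) {C : Finset L} (hC : ∀ a, ρ.perm a ∈ C ↔ a ∈ C)
    (i : (Vertex fun a b c : C => D.N a b c) × (Vertex fun a b c : C => D.N a b c))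
    (j : Vertex D.N × Vertex D.N)
    (h : (ρ.U ⊗ₖ ρ.U) (Prod.map (inclVertex D.N C) (inclVertex D.N C) i) j ≠ 0) :
    j ∈ Set.range (Prod.map (inclVertex D.N C) (inclVertex D.N C)) := by
  simp only [Matrix.kroneckerMap_apply, Prod.map_fst, Prod.map_snd] at h
  obtain ⟨x, hx⟩ := ρ.row_mem hC _ _ (left_ne_zero_of_mul h)
  obtain ⟨y, hy⟩ := ρ.row_mem hC _ _ (right_ne_zero_of_mul h)
  exact ⟨(x, y), Prod.ext hx hy⟩

/-- The restriction of an autoequivalence to a subcategory that it preserves. -/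
def Autoequiv.restrict (ρ : D.Autoequiv) {C : Finset L} (h1 : D.one ∈ C)
    (hC : ∀ a, ρ.perm a ∈ C ↔ a ∈ C) : (D.sub C h1).Autoequiv where
  σ := ρ.σ
  perm := ρ.perm.subtypePerm hC
  U := ρ.U.submatrix (inclVertex D.N C) (inclVertex D.N C)
  U_support i j h := by
    obtain ⟨a1, a2, a3⟩ := ρ.U_support _ _ h
    exact ⟨Subtype.ext a1, Subtype.ext a2, Subtype.ext a3⟩
  U_unitary := by
    rw [Matrix.mem_unitaryGroup_iff, Matrix.star_eq_conjTranspose]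
    have := submatrix_mul_of_row (B := ρ.Uᴴ) (inclVertex_injective D.N C) (ρ.row_mem hC)
    refine this.symm.trans ?_
    rw [unitary_mul ρ.U_unitary]
    exact Matrix.submatrix_one _ (inclVertex_injective D.N C)
  map_F := by
    have hinj := (inclVertex_injective D.N C).prodMap (inclVertex_injective D.N C)
    have e1 : ((D.sub C h1).F).map ρ.σ =
        (D.F.map ρ.σ).submatrix (Prod.map (inclVertex D.N C) (inclVertex D.N C))
          (Prod.map (inclVertex D.N C) (inclVertex D.N C)) := rfl
    rw [e1, ρ.map_F, Matrix.mul_assoc]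
    refine (submatrix_mul_of_row hinj (ρ.row_mem₂ hC)).trans ?_
    rw [submatrix_mul_of_col (B := (ρ.U ⊗ₖ ρ.U)ᴴ) hinj, ← Matrix.mul_assoc]
    · rfl
    · intro i j h
      refine ρ.row_mem₂ hC i j fun h' => h ?_
      rw [Matrix.conjTranspose_apply, h', star_zero]
  map_R := by
    have hinj := inclVertex_injective D.N C
    have e1 : ((D.sub C h1).R).map ρ.σ =
        (D.R.map ρ.σ).submatrix (inclVertex D.N C) (inclVertex D.N C) := rfl
    rw [e1, ρ.map_R, Matrix.mul_assoc]
    refine (submatrix_mul_of_row hinj (ρ.row_mem hC)).trans ?_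
    rw [submatrix_mul_of_col (B := ρ.Uᴴ) hinj, ← Matrix.mul_assoc]
    · rfl
    · intro i j h
      refine ρ.row_mem hC i j fun h' => h ?_
      rw [Matrix.conjTranspose_apply, h', star_zero]

/-- An autoequivalence that fixes `ψ` preserves the even sector. -/
theorem Autoequiv.perm_mem_even_of (ρ : D.Autoequiv) {ψ a : L} (hψ : ρ.perm ψ = ψ)
    (ha : a ∈ D.even ψ) : ρ.perm a ∈ D.even ψ := by
  simp only [even, Finset.mem_filter, Finset.mem_univ, true_and] at ha ⊢
  intro i j h1 h2
  have hU := unitary_mul' ρ.U_unitary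
  have e : D.R * D.R = ρ.Uᴴ * ((D.R * D.R).map ρ.σ * ρ.U) := by
    rw [gal_map_mul, ρ.map_R]
    calc D.R * D.R = 1 * D.R * 1 * D.R * 1 := by simp
      _ = _ := by rw [← hU]; simp only [Matrix.mul_assoc]
  have e2 : (D.R * D.R) i j = (ρ.Uᴴ * ρ.U) i j := by
    rw [e, Matrix.mul_apply, Matrix.mul_apply]
    refine Finset.sum_congr rfl fun m _ => ?_
    by_cases hm : ρ.U m i = 0
    · simp [hm]
    · obtain ⟨a1, a2, -⟩ := ρ.U_support _ _ hm
      have b1 : m.a = a := ρ.perm.injective (by rw [← a1, h1])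
      have b2 : m.b = ψ := ρ.perm.injective (by rw [← a2, h2, hψ])
      congr 1
      rw [Matrix.mul_apply, Finset.sum_eq_single m]
      · simp [ha m m b1 b2]
      · intro n _ hn
        simp [ha m n b1 b2, Ne.symm hn]
      · simp
  rw [e2, hU, Matrix.one_apply]

theorem Autoequiv.perm_mem_even (ρ : D.Autoequiv) {ψ : L} (hψ : ρ.perm ψ = ψ) (a : L) :
    ρ.perm a ∈ D.even ψ ↔ a ∈ D.even ψ := by
  refine ⟨fun h => ?_, ρ.perm_mem_even_of hψ⟩
  have h2 : (ρ⁻¹).perm ψ = ψ := by rw [Autoequiv.inv_perm, Equiv.Perm.inv_eq_iff_eq, hψ]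
  have := (ρ⁻¹).perm_mem_even_of h2 h
  simpa [Autoequiv.inv_perm] using this

theorem kron_entry {n : Type*} [Fintype n] [DecidableEq n] (A : Matrix n n ℂ)
    (F : Matrix (n × n) (n × n) ℂ) (α β μ ν : n) :
    ((A ⊗ₖ 1) * F * (A ⊗ₖ 1) : Matrix (n × n) (n × n) ℂ) (α, β) (μ, ν) =
      ∑ l, ∑ g, A α l * F (l, β) (g, ν) * A g μ := by
  simp only [Matrix.mul_apply, Fintype.sum_prod_type, Matrix.kroneckerMap_apply, Matrix.one_apply,
    mul_ite, mul_one, mul_zero, ite_mul, zero_mul, Finset.sum_ite_eq, Finset.sum_ite_eq',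
    Finset.mem_univ, if_true, Finset.sum_mul]
  rw [Finset.sum_comm]

theorem kron_entry' {n : Type*} [Fintype n] [DecidableEq n] (A : Matrix n n ℂ)
    (F : Matrix (n × n) (n × n) ℂ) (x y : n × n) :
    (F * (1 ⊗ₖ A) * F : Matrix (n × n) (n × n) ℂ) x y = ∑ d, ∑ s, ∑ t, F x (d, s) * A s t * F (d, t) y := by
  simp only [Matrix.mul_apply, Fintype.sum_prod_type, Matrix.kroneckerMap_apply, Matrix.one_apply]
  refine Finset.sum_congr rfl fun d _ => ?_
  rw [Finset.sum_comm (s := (Finset.univ : Finset n)) (t := (Finset.univ : Finset n))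
    (f := fun s t => F x (d, s) * A s t * F (d, t) y)]
  refine Finset.sum_congr rfl fun t _ => ?_
  rw [Finset.sum_eq_single d (fun b _ hb => by simp [hb]) (by simp), Finset.sum_mul]
  simp

theorem vertex_eq {N : L → L → L → ℕ} {u v : Vertex N} (h1 : u.a = v.a) (h2 : u.b = v.b)
    (h3 : u.c = v.c) (hN : N v.a v.b v.c ≤ 1) : u = v := by
  obtain ⟨⟨a, b, c⟩, m⟩ := u
  obtain ⟨⟨a', b', c'⟩, m'⟩ := v
  change a = a' at h1
  change b = b' at h2
  change c = c' at h3
  subst h1 h2 h3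
  have : m = m' := Fin.ext (by
    have e1 := m.2
    have e2 := m'.2
    change N a b c ≤ 1 at hN
    change (m : ℕ) < N a b c at e1
    change (m' : ℕ) < N a b c at e2
    omega)
  rw [this]

namespace IsUBFC

theorem eq_of_snd_one (h : D.IsUBFC) {u v : Vertex D.N} (h1 : u.a = v.a)
    (h2 : u.b = D.one) (h2' : v.b = D.one) (h3 : u.c = v.c) : u = v := by
  refine vertex_eq h1 (h2.trans h2'.symm) h3 ?_
  rw [h2', h.fusion_one]; split_ifs <;> simp

theorem eq_of_fst_one (h : D.IsUBFC) {u v : Vertex D.N} (h1 : u.a = D.one)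
    (h1' : v.a = D.one) (h2 : u.b = v.b) (h3 : u.c = v.c) : u = v := by
  refine vertex_eq (h1.trans h1'.symm) h2 h3 ?_
  rw [h1', h.one_fusion]; split_ifs <;> simp

theorem out_of_fst_one (h : D.IsUBFC) {u : Vertex D.N} (h1 : u.a = D.one) : u.c = u.b := by
  by_contra hne
  have h0 : D.N u.a u.b u.c = 0 := by rw [h1, h.one_fusion, if_neg hne]
  have e : (u.2 : ℕ) < D.N u.a u.b u.c := u.2.2
  omega

theorem exists_one_left (h : D.IsUBFC) (x : L) :
    ∃ l : Vertex D.N, l.a = D.one ∧ l.b = x ∧ l.c = x := by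
  have h0 : 0 < D.N D.one x x := by rw [h.one_fusion]; simp
  exact ⟨⟨(D.one, x, x), ⟨0, h0⟩⟩, rfl, rfl, rfl⟩

theorem exists_one_right (h : D.IsUBFC) (x : L) :
    ∃ l : Vertex D.N, l.a = x ∧ l.b = D.one ∧ l.c = x := by
  have h0 : 0 < D.N x D.one x := by rw [h.fusion_one]; simp
  exact ⟨⟨(x, D.one, x), ⟨0, h0⟩⟩, rfl, rfl, rfl⟩

/-- The hexagon at a strand crossing two vacuum lines. -/
theorem hexagon_one (h : D.IsUBFC) (A : Matrix (Vertex D.N) (Vertex D.N) ℂ)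
    (hA : ∀ u v, A u v ≠ 0 → u.a = v.b ∧ u.b = v.a ∧ u.c = v.c)
    (hex : (A ⊗ₖ 1) * D.F * (A ⊗ₖ 1) = D.F * (1 ⊗ₖ A) * D.F)
    {x : L} {r l : Vertex D.N} (r1 : r.a = x) (r2 : r.b = D.one) (r3 : r.c = x)
    (l1 : l.a = D.one) (l2 : l.b = x) (l3 : l.c = x) :
    A r l * D.F (l, r) (r, l) * A r l = A r l := by
  obtain ⟨u, u1, u2, u3⟩ := h.exists_one_left D.one
  have key := congrFun (congrFun hex (r, r)) (l, l)
  rw [kron_entry, kron_entry', Finset.sum_eq_single l, Finset.sum_eq_single r,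
    Finset.sum_eq_single u, Finset.sum_eq_single r, Finset.sum_eq_single l] at key
  · rw [key, h.triangle r r u r (r3.trans r1.symm) r2 (u3.trans r2.symm) u1,
      h.triangle u l l l (u3.trans l1.symm) u2 (l3.trans l2.symm) l1, if_pos rfl, if_pos rfl,
      one_mul, mul_one]
  · intro t _ ht
    have : A r t = 0 := by
      by_contra h'
      obtain ⟨a1, a2, a3⟩ := hA _ _ h'
      exact ht (h.eq_of_fst_one (by rw [← a2, r2]) l1 (by rw [← a1, r1, l2]) (by rw [← a3, r3, l3]))
    simp [this]
  · simp
  · intro s _ hs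
    refine Finset.sum_eq_zero fun t _ => ?_
    have : D.F (r, r) (u, s) = 0 := by
      by_contra h'
      obtain ⟨a1, a2, a3, a4, a5, a6⟩ := h.F_support _ _ _ _ h'
      exact hs (h.eq_of_snd_one a3.symm (by rw [← a2, u3]) r2 a6.symm)
    simp [this]
  · simp
  · intro d _ hd
    refine Finset.sum_eq_zero fun s _ => Finset.sum_eq_zero fun t _ => ?_
    have : D.F (r, r) (d, s) = 0 := by
      by_contra h'
      obtain ⟨a1, a2, a3, a4, a5, a6⟩ := h.F_support _ _ _ _ h'
      have d1 : d.a = D.one := by rw [← a4, r2]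
      have d2 : d.b = D.one := by rw [← a5, r2]
      exact hd (h.eq_of_fst_one d1 u1 (by rw [d2, u2]) (by rw [h.out_of_fst_one d1, d2, u3]))
    simp [this]
  · simp
  · intro g _ hg
    have : A g l = 0 := by
      by_contra h'
      obtain ⟨a1, a2, a3⟩ := hA _ _ h'
      exact hg (h.eq_of_snd_one (by rw [a1, l2, r1]) (by rw [a2, l1]) r2 (by rw [a3, l3, r3]))
    simp [this]
  · simp
  · intro m _ hm
    refine Finset.sum_eq_zero fun g _ => ?_
    have : A r m = 0 := by
      by_contra h'
      obtain ⟨a1, a2, a3⟩ := hA _ _ h'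
      exact hm (h.eq_of_fst_one (by rw [← a2, r2]) l1 (by rw [← a1, r1, l2]) (by rw [← a3, r3, l3]))
    simp [this]
  · simp

/-- The vacuum braids trivially with every label. -/
theorem one_mem_even (h : D.IsUBFC) (ψ : L) : D.one ∈ D.even ψ := by
  simp only [even, Finset.mem_filter, Finset.mem_univ, true_and]
  intro l j l1 l2
  have l3 : l.c = ψ := by rw [h.out_of_fst_one l1, l2]
  obtain ⟨r, r1, r2, r3⟩ := h.exists_one_right ψ
  have hrow : ∀ m, m ≠ r → D.R l m = 0 := by
    intro m hm
    by_contra h'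
    obtain ⟨a1, a2, a3⟩ := h.R_support _ _ h'
    exact hm (h.eq_of_snd_one (by rw [← a2, l2, r1]) (by rw [← a1, l1]) r2 (by rw [← a3, l3, r3]))
  have hrow' : ∀ m, m ≠ l → D.R r m = 0 := by
    intro m hm
    by_contra h'
    obtain ⟨a1, a2, a3⟩ := h.R_support _ _ h'
    exact hm (h.eq_of_fst_one (by rw [← a2, r2]) l1 (by rw [← a1, r1, l2]) (by rw [← a3, r3, l3]))
  have u1 : D.R l r * star (D.R l r) = 1 := by
    have := congrFun (congrFun (unitary_mul h.R_unitary) l) l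
    rwa [Matrix.mul_apply, Finset.sum_eq_single r (fun m _ hm => by simp [hrow m hm]) (by simp),
      Matrix.conjTranspose_apply, Matrix.one_apply_eq] at this
  have u2 : D.R r l * star (D.R r l) = 1 := by
    have := congrFun (congrFun (unitary_mul h.R_unitary) r) r
    rwa [Matrix.mul_apply, Finset.sum_eq_single l (fun m _ hm => by simp [hrow' m hm]) (by simp),
      Matrix.conjTranspose_apply, Matrix.one_apply_eq] at this
  have e1 := h.hexagon_one D.R h.R_support h.hexagon r1 r2 r3 l1 l2 l3
  have e2 := h.hexagon_one D.Rᴴ (by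
    intro u v huv
    have : D.R v u ≠ 0 := by
      intro h'; exact huv (by simp [h'])
    obtain ⟨a1, a2, a3⟩ := h.R_support _ _ this
    exact ⟨a2.symm, a1.symm, a3.symm⟩) h.hexagon_inv r1 r2 r3 l1 l2 l3
  rw [Matrix.conjTranspose_apply] at e2
  have n1 : D.R r l ≠ 0 := left_ne_zero_of_mul_eq_one u2
  have n2 : star (D.R l r) ≠ 0 := right_ne_zero_of_mul_eq_one u1
  have f1 : D.R r l * D.F (l, r) (r, l) = 1 := mul_right_cancel₀ n1 (by rw [e1, one_mul])
  have f2 : star (D.R l r) * D.F (l, r) (r, l) = 1 := mul_right_cancel₀ n2 (by rw [e2, one_mul])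
  have f3 : D.R r l = star (D.R l r) := by
    have nf := right_ne_zero_of_mul_eq_one f1
    exact mul_right_cancel₀ nf (f1.trans f2.symm)
  rw [Matrix.mul_apply, Finset.sum_eq_single r (fun m _ hm => by simp [hrow m hm]) (by simp)]
  split_ifs with hj
  · rw [← hj, f3, u1]
  · rw [hrow' j (Ne.symm hj), mul_zero]

end IsUBFC

/-- The fermion braids trivially with itself. -/
theorem IsSpinModular.mem_even {ψ : L} (h : D.IsSpinModular ψ) : ψ ∈ D.even ψ := by
  simp only [even, Finset.mem_filter, Finset.mem_univ, true_and]
  intro i j i1 i2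
  have hout : ∀ v : Vertex D.N, v.a = ψ → v.b = ψ → v.c = D.one := by
    intro v h1 h2
    by_contra hne
    have h0 : D.N v.a v.b v.c = 0 := by rw [h1, h2, h.fuse, if_neg hne]
    have e : (v.2 : ℕ) < D.N v.a v.b v.c := v.2.2
    omega
  have huniq : ∀ v : Vertex D.N, v.a = ψ → v.b = ψ → v = i := by
    intro v h1 h2
    refine vertex_eq (h1.trans i1.symm) (h2.trans i2.symm)
      ((hout v h1 h2).trans (hout i i1 i2).symm) ?_
    rw [i1, i2, h.fuse]; split_ifs <;> simp
  have hrow : ∀ m, m ≠ i → D.R i m = 0 := by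
    intro m hm
    by_contra h'
    obtain ⟨a1, a2, -⟩ := h.R_support _ _ h'
    exact hm (huniq m (by rw [← a2, i2]) (by rw [← a1, i1]))
  have u1 : D.R i i * star (D.R i i) = 1 := by
    have := congrFun (congrFun (unitary_mul h.R_unitary) i) i
    rwa [Matrix.mul_apply, Finset.sum_eq_single i (fun m _ hm => by simp [hrow m hm]) (by simp),
      Matrix.conjTranspose_apply, Matrix.one_apply_eq] at this
  have t := h.fermion
  rw [twist, Finset.sum_eq_single i
    (fun m _ hm => if_neg fun hh => hm (huniq m hh.1 hh.2)) (by simp), if_pos ⟨i1, i2⟩] at t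
  obtain ⟨c, hc⟩ : ∃ c : ℝ, c = D.qdim i.c / D.qdim ψ := ⟨_, rfl⟩
  rw [← hc] at t
  have c0 : (c : ℂ) ≠ 0 := by
    intro h0; rw [h0, zero_mul] at t; norm_num at t
  have hR : D.R i i = ((-c⁻¹ : ℝ) : ℂ) := by
    push_cast
    field_simp
    linear_combination t
  rw [hR] at u1
  have u2 : D.R i i * D.R i i = 1 := by
    rw [hR]
    simpa using u1
  rw [Matrix.mul_apply, Finset.sum_eq_single i (fun m _ hm => by simp [hrow m hm]) (by simp)]
  split_ifs with hj
  · rw [← hj, u2]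
  · rw [hrow j (Ne.symm hj), mul_zero]

/-- The super-modular category `C` of a spin modular category: the full subcategory on the even
sector. -/
def evenPart (D : BraidedFusionData L) {ψ : L} (h : D.IsSpinModular ψ) :
    BraidedFusionData (D.even ψ) :=
  D.sub (D.even ψ) (h.one_mem_even ψ)

/-- The fermion as a label of `C`. -/
def evenFermion {ψ : L} (h : D.IsSpinModular ψ) : D.even ψ := ⟨ψ, h.mem_even⟩

/-- The restriction to `C` on representatives. -/
def restrictRep {ψ : L} (h : D.IsSpinModular ψ) :
    lrRep D ψ →* lrRep (D.evenPart h) (evenFermion h) where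
  toFun ρ := ⟨ρ.1.restrict (h.one_mem_even ψ) (ρ.1.perm_mem_even ρ.2.1), by
    refine ⟨Subtype.ext ρ.2.1, ?_⟩
    intro i i1 i2 i3 j
    have := ρ.2.2 (inclVertex D.N (D.even ψ) i) (congrArg Subtype.val i1)
      (congrArg Subtype.val i2) (congrArg Subtype.val i3) (inclVertex D.N (D.even ψ) j)
    refine this.trans ?_
    by_cases hij : i = j
    · simp [hij]
    · have := (inclVertex_injective D.N (D.even ψ)).ne hij
      simp [hij, this]⟩
  map_one' := by
    apply Subtype.ext
    apply Autoequiv.ext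
    · rfl
    · rfl
    · exact Matrix.submatrix_one _ (inclVertex_injective D.N (D.even ψ))
  map_mul' ρ τ := by
    apply Subtype.ext
    apply Autoequiv.ext
    · rfl
    · rfl
    · refine submatrix_mul_of_row (inclVertex_injective D.N (D.even ψ)) ?_
      intro i j hij
      refine τ.1.row_mem (τ.1.perm_mem_even τ.2.1) i j fun h' => hij ?_
      rw [Matrix.map_apply, h', map_zero]

/-- The restriction map `r` from `Aut_LR` of the spin modular category to `Aut_LR(C)`. -/
def restrictAutLR {ψ : L} (h : D.IsSpinModular ψ) :
    AutLR D ψ →* AutLR (D.evenPart h) (evenFermion h) :=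
  QuotientGroup.map _ _ (restrictRep h) (by
    rintro ρ ⟨h1, h2, γ, h3, h4⟩
    refine ⟨h1, ?_, fun a => γ a, h3, ?_⟩
    · ext a
      change ρ.1.perm a = a
      rw [h2]; rfl
    · change ρ.1.U.submatrix _ _ = _
      rw [h4]
      exact Matrix.submatrix_diagonal _ _ (inclVertex_injective D.N (D.even ψ)))

end Restrict

end BraidedFusionData

end

/-! A class in $\ker r$ has a linear representative whose label permutation $f$ fixes every even
label. Since it is linear and conjugates $R$ by a unitary, $f$ preserves the fusion coefficients,
the quantum dimensions and hence $S$ (`Autoequiv.S_perm`).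

The other ingredient is $S_{a,x\times\psi}=M_{a,\psi}S_{a,x}$ with $M_{a,\psi}=\pm1$ (`S_fuse`,
`braidsBy_sq`). The vector $S(e_x+e_{x\times\psi})$ therefore vanishes at odd $a$ and equals
$2S_{a,x}=2S_{a,f(x)}$ at even $a$. It depends only on data that $f$ preserves, so $x$ and $f(x)$
give the same vector. Invertibility of $S$ forces $\{x,x\times\psi\}=\{f(x),f(x)\times\psi\}$, that
is, $f(x)=x$ or $f(x)=x\times\psi$ (`eq_or_fusesTo`).

Let $q(x)=0$ exactly when $f(x)=x$. If a vortex $u$ is fixed and $v$ is moved, then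
$S_{u,v}=S_{u,v\times\psi}=-S_{u,v}$, so $S_{u,v}=0$. The level sets of $q$ thus decouple, and an
indecomposable block lies in one of them. A $\sigma$-type vortex has $x\times\psi=x$, so it is
fixed.

The formula for $S_{a,x\times\psi}$ rests on the hexagons, which write the double braid of $a$ with
a fused pair through its double braids with the two constituents (`monodromy_right_tree`,
`braidTrace_fuse`), and on $d_{c\times\psi}=d_c$ (`qdim_fuse`). -/

namespace BraidedFusionData

/-! ### Sliding diagonal weights through matrices -/

section Diagonal

variable {m n : Type*} [Fintype m] [Fintype n] [DecidableEq m] [DecidableEq n]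

/-- Label bookkeeping in matrix form: $F$, $R$ and $U$ have nonzero entries only between compatible
labels, so a projection onto, or a weight on, given labels can be moved past them inside a trace. -/
theorem diagonal_mul_eq_mul_diagonal {g : m → ℂ} {h : n → ℂ} {A : Matrix m n ℂ}
    (hA : ∀ i j, A i j ≠ 0 → g i = h j) : diagonal g * A = A * diagonal h := by
  ext i j
  rw [diagonal_mul, mul_diagonal]
  by_cases h0 : A i j = 0
  · simp [h0]
  · rw [hA i j h0, mul_comm]

theorem trace_diagonal_mul (g : m → ℂ) (A : Matrix m m ℂ) :
    trace (diagonal g * A) = ∑ i, g i * A i i := by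
  simp [trace, diagonal_mul]

end Diagonal

/-- The square of the braiding in terms of two hexagons, as an identity in a ring. -/
theorem mul_sq_of_hexagons {M : Type*} [Ring M] {F G A C P Q : M} (hP : F * G = P)
    (hQ : G * F = Q) (hQC : Q * C = C * P) (hPC : P * C = C * Q) (hAQ : A * Q = Q * A)
    (hQG : Q * G = G) (h1 : A * F * A = F * C * F) (h2 : A * G * A = G * C * G) :
    Q * (C * C) = G * A * F * (A * A) * G * A * F := by
  have hQQ : Q * Q = Q := by
    conv_lhs => rw [← hQ, ← mul_assoc, hQ, hQG]
    exact hQ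
  have hPP : P * P = P := by
    calc P * P = F * (G * F) * G := by rw [← hP]; simp only [mul_assoc]
      _ = P := by rw [hQ, mul_assoc, hQG, hP]
  -- In the application $G=F^\dagger$, and $P$, $Q$ are the projections onto composable left and
  -- right trees. Each factor is a sandwiched hexagon: $QCP=G(FCF)G$ and $PCQ=F(GCG)F$.
  calc Q * (C * C) = (Q * C * P) * (P * C * Q) := by
        calc Q * (C * C) = (Q * C) * C := by rw [mul_assoc]
          _ = C * P * C := by rw [hQC]
          _ = C * (P * P) * P * P * C := by simp only [hPP, mul_assoc]
          _ = (C * P) * P * P * (P * C) := by simp only [mul_assoc]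
          _ = (Q * C) * P * P * (P * C) := by rw [hQC]
          _ = (Q * C) * P * (P * P * C) := by simp only [mul_assoc]
          _ = (Q * C) * P * (P * C * Q) := by rw [hPP, mul_assoc P C Q, ← hPC, ← mul_assoc P P, hPP]
    _ = G * (F * C * F) * G * (F * (G * C * G) * F) := by
        rw [← hP, ← hQ]; simp only [mul_assoc]
    _ = G * (A * F * A) * (G * F) * (A * G * A) * F := by
        rw [h1, h2]; simp only [mul_assoc]
    _ = G * A * F * (A * (Q * A) * G) * A * F := by
        rw [hQ]; simp only [mul_assoc]
    _ = G * A * F * (A * A * (Q * G)) * A * F := by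
        rw [← hAQ]; simp only [mul_assoc]
    _ = _ := by rw [hQG]; simp only [mul_assoc]

/-! ### Double braid traces and fusion rules -/

section Trace

variable {L : Type*} [Fintype L] [DecidableEq L] {D : BraidedFusionData L}

theorem sum_vertex (N : L → L → L → ℕ) (a b : L) (w : L → ℂ) :
    (∑ v : Vertex N, if v.a = a ∧ v.b = b then w v.c else 0) = ∑ c, (N a b c : ℂ) * w c := by
  rw [Fintype.sum_sigma, Fintype.sum_prod_type, Finset.sum_eq_single a, Fintype.sum_prod_type,
    Finset.sum_eq_single b]
  · refine Finset.sum_congr rfl fun c _ => ?_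
    change (∑ _m : Fin (N a b c), if a = a ∧ b = b then w c else 0) = _
    simp
  · intro x _ hx
    simp [hx]
  · simp
  · intro x _ hx
    simp [hx]
  · simp

theorem FusesTo.sum_vertex {a b c : L} (h : D.FusesTo a b c) (w : L → ℂ) :
    (∑ v : Vertex D.N, if v.a = a ∧ v.b = b then w v.c else 0) = w c := by
  rw [BraidedFusionData.sum_vertex, Finset.sum_eq_single c]
  · simp [h c]
  · intro x _ hx
    simp [h x, hx]
  · simp

/-- The trace of the double braid of `a` and `b`, the channel `c` being weighted by `w c`. -/
def braidTrace (D : BraidedFusionData L) (w : L → ℂ) (a b : L) : ℂ :=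
  ∑ i : Vertex D.N, if i.a = a ∧ i.b = b then w i.c * (D.R * D.R) i i else 0

theorem S_eq_braidTrace (D : BraidedFusionData L) (a b : L) :
    D.S a b = (D.totalDim : ℂ)⁻¹ * D.braidTrace (fun c => (D.qdim c : ℂ)) a b := rfl

theorem braidTrace_eq_trace (w : L → ℂ) (a b : L) :
    D.braidTrace w a b =
      trace (diagonal (fun i : Vertex D.N => if i.a = a ∧ i.b = b then w i.c else 0) *
        (D.R * D.R)) := by
  rw [trace_diagonal_mul, braidTrace]
  exact Finset.sum_congr rfl fun i _ => by split_ifs <;> simp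

namespace IsUBFC

/-- Cyclicity of the trace moves one factor $R$ around, and $R$ exchanges the two incoming labels
while keeping the channel. -/
theorem braidTrace_comm (h : D.IsUBFC) (w : L → ℂ) (a b : L) :
    D.braidTrace w a b = D.braidTrace w b a := by
  rw [braidTrace_eq_trace, braidTrace_eq_trace, ← Matrix.mul_assoc,
    diagonal_mul_eq_mul_diagonal (A := D.R)
      (h := fun i : Vertex D.N => if i.a = b ∧ i.b = a then w i.c else 0),
    Matrix.mul_assoc, trace_mul_comm, Matrix.mul_assoc]
  intro i j hij
  obtain ⟨h1, h2, h3⟩ := h.R_support i j hij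
  simp only [h1, h2, h3, and_comm]

theorem S_comm (h : D.IsUBFC) (a b : L) : D.S a b = D.S b a := by
  rw [S_eq_braidTrace, S_eq_braidTrace, h.braidTrace_comm]

/-- The unitary $R$ maps one splitting space onto the other; the dimensions are compared as traces
of projections. -/
theorem fusion_comm (h : D.IsUBFC) (a b c : L) : D.N a b c = D.N b a c := by
  have key : ∀ a b, (D.N a b c : ℂ) =
      trace (diagonal (fun i : Vertex D.N =>
        if i.a = a ∧ i.b = b then (if i.c = c then (1 : ℂ) else 0) else 0)) := by
    intro a b
    rw [trace_diagonal, sum_vertex D.N a b fun e => if e = c then 1 else 0]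
    simp
  have e : (D.N a b c : ℂ) = D.N b a c := by
    rw [key a b, key b a]
    calc _ = trace (diagonal (fun i : Vertex D.N =>
          if i.a = a ∧ i.b = b then (if i.c = c then (1 : ℂ) else 0) else 0) * (D.R * D.Rᴴ)) := by
            rw [unitary_mul h.R_unitary, Matrix.mul_one]
      _ = _ := by
        rw [← Matrix.mul_assoc, diagonal_mul_eq_mul_diagonal (A := D.R)
          (h := fun i : Vertex D.N =>
            if i.a = b ∧ i.b = a then (if i.c = c then (1 : ℂ) else 0) else 0),
          Matrix.mul_assoc, trace_mul_comm, Matrix.mul_assoc, unitary_mul' h.R_unitary,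
          Matrix.mul_one]
        intro i j hij
        obtain ⟨h1, h2, h3⟩ := h.R_support i j hij
        simp only [h1, h2, h3, and_comm]
  exact_mod_cast e

/-- $F$ is a partial isometry from right trees to left trees that keeps the four outer labels, so
both spaces of trees have the same dimension. -/
theorem fusion_assoc (h : D.IsUBFC) (a b c d : L) :
    ∑ e, D.N a b e * D.N e c d = ∑ f, D.N b c f * D.N a f d := by
  let g : Vertex D.N × Vertex D.N → ℂ := fun x =>
    if x.1.a = a ∧ x.1.b = b ∧ x.2.b = c ∧ x.2.c = d then 1 else 0
  let g' : Vertex D.N × Vertex D.N → ℂ := fun x =>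
    if x.2.a = a ∧ x.1.a = b ∧ x.1.b = c ∧ x.2.c = d then 1 else 0
  have hg : diagonal g * D.F = D.F * diagonal g' := by
    apply diagonal_mul_eq_mul_diagonal
    rintro ⟨u, v⟩ ⟨p, q⟩ huv
    obtain ⟨-, -, h1, h2, h3, h4⟩ := h.F_support u v p q huv
    simp only [g, g', h1, h2, h3, h4]
  have ht : trace (diagonal g * (D.F * D.Fᴴ)) = trace (diagonal g' * (D.Fᴴ * D.F)) := by
    rw [← Matrix.mul_assoc, hg, Matrix.mul_assoc, trace_mul_comm, Matrix.mul_assoc]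
  rw [h.F_mul_star, h.star_mul_F, diagonal_mul_diagonal, diagonal_mul_diagonal, trace_diagonal,
    trace_diagonal, Fintype.sum_prod_type, Fintype.sum_prod_type] at ht
  have e1 : ∀ u : Vertex D.N, (∑ v : Vertex D.N, g (u, v) * if u.c = v.a then 1 else 0) =
      if u.a = a ∧ u.b = b then (D.N u.c c d : ℂ) else 0 := by
    intro u
    have := sum_vertex D.N u.c c (fun e => if e = d then 1 else 0)
    simp only [mul_ite, mul_one, mul_zero, Finset.sum_ite_eq', Finset.mem_univ, if_true] at this
    by_cases hu : u.a = a ∧ u.b = b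
    · rw [if_pos hu, ← this]
      refine Finset.sum_congr rfl fun v _ => ?_
      simp only [g, hu.1, hu.2, true_and, eq_comm (a := v.a)]
      by_cases h1 : u.c = v.a <;> by_cases h2 : v.b = c <;> simp [h1, h2]
    · rw [if_neg hu]
      refine Finset.sum_eq_zero fun v _ => ?_
      simp only [g]
      rw [if_neg (by tauto), zero_mul]
  have e2 : ∀ u : Vertex D.N, (∑ v : Vertex D.N, g' (u, v) * if u.c = v.b then 1 else 0) =
      if u.a = b ∧ u.b = c then (D.N a u.c d : ℂ) else 0 := by
    intro u
    have := sum_vertex D.N a u.c (fun e => if e = d then 1 else 0)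
    simp only [mul_ite, mul_one, mul_zero, Finset.sum_ite_eq', Finset.mem_univ, if_true] at this
    by_cases hu : u.a = b ∧ u.b = c
    · rw [if_pos hu, ← this]
      refine Finset.sum_congr rfl fun v _ => ?_
      simp only [g', hu.1, hu.2, true_and, eq_comm (a := v.b)]
      by_cases h1 : u.c = v.b <;> by_cases h2 : v.a = a <;> simp [h1, h2]
    · rw [if_neg hu]
      refine Finset.sum_eq_zero fun v _ => ?_
      simp only [g']
      rw [if_neg (by tauto), zero_mul]
  simp only [e1, e2] at ht
  rw [sum_vertex D.N a b (fun e => (D.N e c d : ℂ)),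
    sum_vertex D.N b c (fun e => (D.N a e d : ℂ))] at ht
  exact_mod_cast ht

/-- The double braid of a strand with a fused pair of strands. -/
theorem monodromy_right_tree (h : D.IsUBFC) :
    diagonal (fun x : Vertex D.N × Vertex D.N => if x.1.c = x.2.b then (1 : ℂ) else 0) *
        (1 ⊗ₖ (D.R * D.R)) =
      D.Fᴴ * (D.R ⊗ₖ 1) * D.F * ((D.R * D.R) ⊗ₖ 1) * D.Fᴴ * (D.R ⊗ₖ 1) * D.F := by
  have hA : (D.R * D.R) ⊗ₖ (1 : Matrix (Vertex D.N) (Vertex D.N) ℂ) =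
      (D.R ⊗ₖ 1) * (D.R ⊗ₖ 1) := by
    rw [← mul_kronecker_mul, Matrix.mul_one]
  have hC : (1 : Matrix (Vertex D.N) (Vertex D.N) ℂ) ⊗ₖ (D.R * D.R) =
      (1 ⊗ₖ D.R) * (1 ⊗ₖ D.R) := by
    rw [← mul_kronecker_mul, Matrix.mul_one]
  rw [hA, hC]
  have key : ∀ i j, (1 ⊗ₖ D.R : Matrix (Vertex D.N × Vertex D.N) _ ℂ) i j ≠ 0 →
      i.1 = j.1 ∧ i.2.a = j.2.b ∧ i.2.b = j.2.a := by
    rintro ⟨p, q⟩ ⟨p', q'⟩ hij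
    rw [kroneckerMap_apply] at hij
    obtain ⟨h1, h2, -⟩ := h.R_support _ _ (right_ne_zero_of_mul hij)
    refine ⟨?_, h1, h2⟩
    by_contra hp
    exact left_ne_zero_of_mul hij (one_apply_ne hp)
  refine mul_sq_of_hexagons h.F_mul_star h.star_mul_F ?_ ?_ ?_ ?_ h.hexagon ?_
  · apply diagonal_mul_eq_mul_diagonal
    intro i j hij
    obtain ⟨h1, h2, h3⟩ := key i j hij
    rw [h1, h3]
  · apply diagonal_mul_eq_mul_diagonal
    intro i j hij
    obtain ⟨h1, h2, h3⟩ := key i j hij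
    rw [h1, h2]
  · symm
    apply diagonal_mul_eq_mul_diagonal
    rintro ⟨p, q⟩ ⟨p', q'⟩ hij
    rw [kroneckerMap_apply] at hij
    obtain ⟨-, -, h3⟩ := h.R_support _ _ (left_ne_zero_of_mul hij)
    have hq : q = q' := by
      by_contra hp
      exact right_ne_zero_of_mul hij (one_apply_ne hp)
    change p.c = p'.c at h3
    simp only [h3, hq]
  · ext ⟨p, q⟩ ⟨u, v⟩
    rw [diagonal_mul]
    by_cases h0 : D.F (u, v) (p, q) = 0
    · simp [conjTranspose_apply, h0]
    · rw [if_pos (h.F_support _ _ _ _ h0).2.1, one_mul]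
  -- The adjoint of the hexagon for $R^\dagger$ is a hexagon for $R$ with $F^\dagger$ in place of
  -- $F$.
  · have e := congrArg conjTranspose h.hexagon_inv
    simp only [conjTranspose_mul, conjTranspose_kronecker, conjTranspose_conjTranspose,
      conjTranspose_one, Matrix.mul_assoc] at e
    simpa only [Matrix.mul_assoc] using e

/-- If `m` is the double braid of `a` around `p`, fusing `p` to `x` multiplies the double braid
trace of `x` with `a` by `m`. -/
theorem braidTrace_fuse (h : D.IsUBFC) {a x p y : L} {m : ℂ} (hy : D.FusesTo x p y)
    (hm : D.BraidsBy p m a) {τ : L → L} (hτ : ∀ c, D.FusesTo c p (τ c)) (w : L → ℂ) :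
    D.braidTrace w a y = m * D.braidTrace (fun c => w (τ c)) x a := by
  let T := Vertex D.N × Vertex D.N
  let A : Matrix T T ℂ := D.R ⊗ₖ 1
  let A₂ : Matrix T T ℂ := (D.R * D.R) ⊗ₖ 1
  let P : Matrix T T ℂ := diagonal fun z => if z.1.c = z.2.a then 1 else 0
  -- The same weight $w$ on trees with outer strands $x$, $p$, $a$, at the successive stages of the
  -- braiding: $a(xp)$, $(ax)p$, $(xa)p$, $x(ap)$.
  let g₁ : T → ℂ := fun z => if z.1.a = x ∧ z.1.b = p ∧ z.2.a = a then w z.2.c else 0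
  let g₂ : T → ℂ := fun z => if z.1.b = x ∧ z.2.b = p ∧ z.1.a = a then w z.2.c else 0
  let g₃ : T → ℂ := fun z => if z.1.a = x ∧ z.2.b = p ∧ z.1.b = a then w z.2.c else 0
  let g₄ : T → ℂ := fun z => if z.2.a = x ∧ z.1.b = p ∧ z.1.a = a then w z.2.c else 0
  have hP : D.F * D.Fᴴ = P := h.F_mul_star
  have hA₂ : A₂ = A * A := by
    simp only [A, A₂]
    rw [← mul_kronecker_mul, Matrix.mul_one]
  have hAs : ∀ i j, A i j ≠ 0 → i.2 = j.2 ∧ i.1.a = j.1.b ∧ i.1.b = j.1.a ∧ i.1.c = j.1.c := by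
    rintro ⟨u, v⟩ ⟨u', v'⟩ hij
    simp only [A] at hij
    rw [kroneckerMap_apply] at hij
    refine ⟨?_, h.R_support _ _ (left_ne_zero_of_mul hij)⟩
    by_contra hp
    exact right_ne_zero_of_mul hij (one_apply_ne hp)
  have c1 : diagonal g₁ * D.Fᴴ = D.Fᴴ * diagonal g₂ := by
    apply diagonal_mul_eq_mul_diagonal
    rintro ⟨u, v⟩ ⟨u', v'⟩ hij
    rw [conjTranspose_apply, star_ne_zero] at hij
    obtain ⟨-, -, h1, h2, h3, h4⟩ := h.F_support _ _ _ _ hij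
    simp only [g₁, g₂, h1, h2, h3, h4]
  have c2 : diagonal g₂ * A = A * diagonal g₃ := by
    apply diagonal_mul_eq_mul_diagonal
    intro i j hij
    obtain ⟨h1, h2, h3, -⟩ := hAs i j hij
    simp only [g₂, g₃, h1, h2, h3]
  have c3 : diagonal g₃ * D.F = D.F * diagonal g₄ := by
    apply diagonal_mul_eq_mul_diagonal
    rintro ⟨u, v⟩ ⟨u', v'⟩ hij
    obtain ⟨-, -, h1, h2, h3, h4⟩ := h.F_support _ _ _ _ hij
    simp only [g₃, g₄, h1, h2, h3, h4]
  -- At stage $x(ap)$ the inner vertex joins $a$ and $p$, so its double braid is the scalar $m$.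
  have c4 : diagonal g₄ * A₂ = m • diagonal g₄ := by
    ext ⟨u, v⟩ ⟨u', v'⟩
    rw [diagonal_mul, Matrix.smul_apply, smul_eq_mul]
    by_cases hu : v.a = x ∧ u.b = p ∧ u.a = a
    · simp only [A₂]
      have hT : ((u, v) : T) = (u', v') ↔ u = u' ∧ v = v' := Prod.mk_inj
      rw [kroneckerMap_apply, hm u u' hu.2.2 hu.2.1, diagonal_apply, one_apply]
      simp only [hT]
      by_cases h1 : u = u' <;> by_cases h2 : v = v' <;> simp [h1, h2, mul_comm]
    · have h0 : g₄ (u, v) = 0 := if_neg hu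
      rw [h0, zero_mul, diagonal_apply, h0, ite_self, mul_zero]
  have c5 : P * A = A * P := by
    apply diagonal_mul_eq_mul_diagonal
    intro i j hij
    obtain ⟨h1, -, -, h3⟩ := hAs i j hij
    simp only [h1, h3]
  have c6 : P * P = P := by
    simp only [P]
    rw [diagonal_mul_diagonal]
    congr 1
    ext z
    split_ifs <;> simp
  have main : trace (diagonal g₁ *
      (diagonal (fun z : T => if z.1.c = z.2.b then (1 : ℂ) else 0) * (1 ⊗ₖ (D.R * D.R)))) =
      m * trace (diagonal g₃ * (P * A₂)) := by
    rw [h.monodromy_right_tree]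
    calc _ = trace ((diagonal g₁ * D.Fᴴ) * (A * D.F * A₂ * D.Fᴴ * A * D.F)) := by
          simp only [A, A₂, Matrix.mul_assoc]
      _ = trace (D.Fᴴ * (diagonal g₂ * A) * (D.F * A₂ * D.Fᴴ * A * D.F)) := by
          rw [c1]; simp only [Matrix.mul_assoc]
      _ = trace (D.Fᴴ * A * (diagonal g₃ * D.F) * (A₂ * D.Fᴴ * A * D.F)) := by
          rw [c2]; simp only [Matrix.mul_assoc]
      _ = trace (D.Fᴴ * A * D.F * (diagonal g₄ * A₂) * (D.Fᴴ * A * D.F)) := by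
          rw [c3]; simp only [Matrix.mul_assoc]
      _ = m * trace (D.Fᴴ * A * (D.F * diagonal g₄) * (D.Fᴴ * A * D.F)) := by
          rw [c4, Matrix.mul_smul, Matrix.smul_mul, trace_smul, smul_eq_mul]
          simp only [Matrix.mul_assoc]
      _ = m * trace (D.Fᴴ * (A * diagonal g₃ * (D.F * D.Fᴴ) * A * D.F)) := by
          rw [← c3]; simp only [Matrix.mul_assoc]
      _ = m * trace (A * (diagonal g₃ * (D.F * D.Fᴴ) * A * (D.F * D.Fᴴ))) := by
          rw [trace_mul_comm]; simp only [Matrix.mul_assoc]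
      _ = m * trace (diagonal g₃ * (P * A * P * A)) := by
          rw [hP, trace_mul_comm]; simp only [Matrix.mul_assoc]
      _ = _ := by
          rw [c5, Matrix.mul_assoc A P P, c6, ← c5, hA₂, Matrix.mul_assoc]
  rw [trace_diagonal_mul, trace_diagonal_mul] at main
  simp only [P, A₂, diagonal_mul, kroneckerMap_apply, one_apply_eq, one_mul, mul_one] at main
  rw [Fintype.sum_prod_type_right, Fintype.sum_prod_type] at main
  rw [braidTrace, braidTrace]
  convert main using 1
  -- The inner vertex $|x,p;y\rangle$ is unique, so the sum over right trees is a sum over the outer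
  -- vertex.
  · refine Finset.sum_congr rfl fun q _ => ?_
    have e := hy.sum_vertex fun c => if q.a = a ∧ c = q.b then w q.c * (D.R * D.R) q q else 0
    simp only [eq_comm (a := y)] at e
    rw [← e]
    refine Finset.sum_congr rfl fun v _ => ?_
    simp only [g₁]
    by_cases h1 : v.a = x <;> by_cases h2 : v.b = p <;> by_cases h3 : q.a = a <;>
      by_cases h4 : v.c = q.b <;> simp [h1, h2, h3, h4]
  · congr 1
    -- Dually, the outer vertex is determined by the inner channel $c$ and ends in $\tau(c)$, which
    -- shifts the weight.
    refine Finset.sum_congr rfl fun u _ => ?_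
    have e := (hτ u.c).sum_vertex fun c =>
      if u.a = x ∧ u.b = a then w c * (D.R * D.R) u u else 0
    rw [← e]
    refine Finset.sum_congr rfl fun v _ => ?_
    simp only [g₃]
    by_cases h1 : u.a = x <;> by_cases h2 : v.b = p <;> by_cases h3 : u.b = a <;>
      by_cases h4 : u.c = v.a <;> simp [h1, h2, h3, h4, eq_comm (a := v.a)]

end IsUBFC

end Trace

/-! ### Vertices of single-channel fusion products -/

section Fuse

variable {L : Type*} [DecidableEq L] {D : BraidedFusionData L}

theorem FusesTo.unique {a b c c' : L} (h : D.FusesTo a b c) (h' : D.FusesTo a b c') : c = c' := by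
  by_contra hne
  have := h c
  rw [h', if_pos rfl, if_neg hne] at this
  exact zero_ne_one this

theorem FusesTo.c_eq {v : Vertex D.N} {c : L} (h : D.FusesTo v.a v.b c) : v.c = c := by
  by_contra hne
  have h0 : D.N v.a v.b v.c = 0 := by rw [h, if_neg hne]
  have e : (v.2 : ℕ) < D.N v.a v.b v.c := v.2.2
  omega

theorem FusesTo.exists_vertex {a b c : L} (h : D.FusesTo a b c) :
    ∃ v : Vertex D.N, v.a = a ∧ v.b = b ∧ v.c = c := by
  have h0 : 0 < D.N a b c := by rw [h]; simp
  exact ⟨⟨(a, b, c), ⟨0, h0⟩⟩, rfl, rfl, rfl⟩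

end Fuse

/-! ### Quantum dimensions and fusion with a label of order two -/

section Dimension

variable {L : Type*} [Fintype L] [DecidableEq L] {D : BraidedFusionData L}

/-- By spectral mapping for squares, each eigenvalue of $A$ is, up to sign, an eigenvalue of $B$. -/
theorem spectralRadius_le_of_sq_eq {n : Type*} [Fintype n] [DecidableEq n] {A B : Matrix n n ℂ}
    (h : A ^ 2 = B ^ 2) : spectralRadius ℂ A ≤ spectralRadius ℂ B := by
  refine iSup₂_le fun k hk => ?_
  have h1 : k ^ 2 ∈ spectrum ℂ (B ^ 2) := by
    rw [← h, spectrum.map_pow_of_pos A two_pos]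
    exact ⟨k, hk, rfl⟩
  rw [spectrum.map_pow_of_pos B two_pos] at h1
  obtain ⟨l, hl, hlk⟩ := h1
  have h2 : ‖l‖₊ = ‖k‖₊ := by
    have := congrArg nnnorm hlk
    simp only [nnnorm_pow] at this
    exact (pow_left_inj₀ zero_le zero_le two_ne_zero).1 this
  rw [← h2]
  exact le_iSup₂ (f := fun (k : ℂ) (_ : k ∈ spectrum ℂ B) => (‖k‖₊ : ENNReal)) l hl

/-- The fusion matrix `(N_{ab}^c)_{b,c}` over `ℂ`. -/
def fusionMatrix (D : BraidedFusionData L) (a : L) : Matrix L L ℂ :=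
  Matrix.of fun b c => (D.N a b c : ℂ)

theorem qdim_eq_of_sq_eq {a b : L} (h : D.fusionMatrix a ^ 2 = D.fusionMatrix b ^ 2) :
    D.qdim a = D.qdim b :=
  congrArg ENNReal.toReal
    (le_antisymm (spectralRadius_le_of_sq_eq h) (spectralRadius_le_of_sq_eq h.symm))

namespace IsUBFC

theorem fusionMatrix_one (h : D.IsUBFC) : D.fusionMatrix D.one = 1 := by
  ext b c
  simp [fusionMatrix, h.one_fusion, one_apply, eq_comm]

/-- Associativity of fusion with $c$ as the only intermediate channel. The factors appear reversed
because rows index the incoming label. -/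
theorem fusionMatrix_of_fusesTo (h : D.IsUBFC) {a b c : L} (hc : D.FusesTo a b c) :
    D.fusionMatrix c = D.fusionMatrix b * D.fusionMatrix a := by
  ext x y
  have e := h.fusion_assoc a b x y
  rw [Finset.sum_eq_single c (fun z _ hz => by simp [hc z, hz]) (by simp), hc c, if_pos rfl,
    one_mul] at e
  simp only [fusionMatrix, mul_apply, of_apply]
  exact_mod_cast e

theorem fusesTo_comm (h : D.IsUBFC) {a b c : L} (hc : D.FusesTo a b c) : D.FusesTo b a c :=
  fun x => by rw [h.fusion_comm, hc x]

theorem fusesTo_one (h : D.IsUBFC) (a : L) : D.FusesTo a D.one a := h.fusion_one a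

/-- Fusion with a label of order two preserves the quantum dimension. -/
theorem qdim_fuse (h : D.IsUBFC) {p c c' : L} (hp : D.FusesTo p p D.one)
    (hc : D.FusesTo c p c') : D.qdim c' = D.qdim c := by
  -- Squares suffice: $N_{c'}$ equals both $N_cN_p$ and $N_pN_c$, so $N_{c'}^2=N_cN_p^2N_c=N_c^2$.
  -- No Perron–Frobenius argument is needed.
  apply qdim_eq_of_sq_eq
  have e1 := h.fusionMatrix_of_fusesTo hc
  have e2 := h.fusionMatrix_of_fusesTo (h.fusesTo_comm hc)
  have e3 := h.fusionMatrix_of_fusesTo hp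
  rw [h.fusionMatrix_one] at e3
  calc D.fusionMatrix c' ^ 2 = D.fusionMatrix c * (D.fusionMatrix p * D.fusionMatrix p) *
        D.fusionMatrix c := by
        rw [sq]
        nth_rewrite 1 [e2]
        rw [e1]
        simp only [Matrix.mul_assoc]
    _ = _ := by rw [← e3, Matrix.mul_one, sq]

/-- A label of order two fuses with every label to a single label. -/
theorem exists_fusesTo (h : D.IsUBFC) {p : L} (hp : D.FusesTo p p D.one) (a : L) :
    ∃ c, D.FusesTo a p c := by
  -- Associativity together with $p\times p=1$. The terms are natural numbers, so for $d=a$ exactly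
  -- one is nonzero, and it is $1$.
  have key : ∀ a d, ∑ e, D.N a p e * D.N e p d = if d = a then 1 else 0 := by
    intro a d
    rw [h.fusion_assoc, Finset.sum_eq_single D.one (fun z _ hz => by simp [hp z, hz]) (by simp),
      hp, if_pos rfl, one_mul, h.fusion_one]
  have hle : ∀ a d e, D.N a p e * D.N e p d ≤ if d = a then 1 else 0 := fun a d e => by
    rw [← key a d]
    exact Finset.single_le_sum (f := fun e => D.N a p e * D.N e p d) (fun _ _ => Nat.zero_le _)
      (Finset.mem_univ e)
  have hex : ∀ a, ∃ e, D.N a p e * D.N e p a ≠ 0 := fun a => by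
    by_contra! h0
    have := key a a
    simp [h0] at this
  obtain ⟨e, he⟩ := hex a
  refine ⟨e, fun e' => ?_⟩
  split_ifs with hee
  · subst hee
    have h1 := hle a a e'
    rw [if_pos rfl] at h1
    exact Nat.eq_one_of_mul_eq_one_right (le_antisymm h1 (Nat.one_le_iff_ne_zero.2 he))
  -- A second channel $e'$ would fuse with $p$ to some $d$, necessarily $d=a$, and add a second
  -- positive term to a sum equal to $1$.
  · by_contra h0
    obtain ⟨d, hd⟩ := hex e'
    have hd0 := left_ne_zero_of_mul hd
    have hda : d = a := by
      by_contra hne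
      have := hle a d e'
      rw [if_neg hne] at this
      exact mul_ne_zero h0 hd0 (Nat.le_zero.1 this)
    rw [hda] at hd0
    have h2 := key a a
    rw [if_pos rfl] at h2
    have h3 := Finset.add_le_sum (f := fun e => D.N a p e * D.N e p a)
      (fun _ _ => Nat.zero_le _) (Finset.mem_univ e) (Finset.mem_univ e') (Ne.symm hee)
    have h4 := Nat.pos_of_ne_zero he
    have h5 := Nat.pos_of_ne_zero (mul_ne_zero h0 hd0)
    omega

end IsUBFC

theorem FusesTo.vertex_unique {a b c : L} (h : D.FusesTo a b c) {u v : Vertex D.N}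
    (hu : u.a = a) (hu' : u.b = b) (hv : v.a = a) (hv' : v.b = b) : u = v := by
  have h1 : v.c = c := FusesTo.c_eq (by rwa [hv, hv'])
  have h2 : u.c = c := FusesTo.c_eq (by rwa [hu, hu'])
  refine vertex_eq (hu.trans hv.symm) (hu'.trans hv'.symm) (h2.trans h1.symm) ?_
  rw [hv, hv', h]
  rw [if_pos h1]

theorem BraidsBy.braidTrace_eq {a b c : L} {m : ℂ} (hm : D.BraidsBy b m a)
    (hc : D.FusesTo a b c) : D.braidTrace (fun _ => 1) a b = m := by
  obtain ⟨v, h1, h2, -⟩ := hc.exists_vertex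
  rw [braidTrace, Finset.sum_eq_single v, if_pos ⟨h1, h2⟩, hm v v h1 h2, if_pos rfl, one_mul]
  · intro u _ hu
    exact if_neg fun hh => hu (hc.vertex_unique hh.1 hh.2 h1 h2)
  · simp

namespace IsUBFC

/-- The double braid around an abelian fusion channel is a scalar. -/
theorem exists_braidsBy (h : D.IsUBFC) {a b c : L} (hc : D.FusesTo a b c) :
    ∃ m, D.BraidsBy b m a := by
  obtain ⟨v, h1, h2, -⟩ := hc.exists_vertex
  refine ⟨(D.R * D.R) v v, fun i j hi hi' => ?_⟩
  have hiv := hc.vertex_unique hi hi' h1 h2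
  subst hiv
  split_ifs with hij
  · rw [hij]
  · rw [mul_apply]
    refine Finset.sum_eq_zero fun k _ => ?_
    by_contra h0
    obtain ⟨a1, a2, -⟩ := h.R_support _ _ (left_ne_zero_of_mul h0)
    obtain ⟨b1, b2, -⟩ := h.R_support _ _ (right_ne_zero_of_mul h0)
    exact hij (hc.vertex_unique hi hi' (by rw [← b2, ← a1, hi]) (by rw [← b1, ← a2, hi']))

theorem braidsBy_one (h : D.IsUBFC) (a : L) : D.BraidsBy a 1 D.one := by
  simpa [even] using h.one_mem_even a

/-- The double braid around a label of order two is a sign. -/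
theorem braidsBy_sq (h : D.IsUBFC) {p a : L} {m : ℂ} (hp : D.FusesTo p p D.one)
    (hm : D.BraidsBy p m a) : m * m = 1 := by
  choose τ hτ using h.exists_fusesTo hp
  -- Braiding $a$ with $p\times p=1$ is trivial; computed by fusion it is $m\cdot m$. The constant
  -- weight $1$ keeps dimensions out of the argument.
  have h1 : D.braidTrace (fun _ => 1) a D.one = 1 := by
    rw [h.braidTrace_comm]
    exact (h.braidsBy_one a).braidTrace_eq (h.fusesTo_comm (h.fusesTo_one a))
  have h2 := h.braidTrace_fuse hp hm hτ fun _ => 1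
  rw [h1, h.braidTrace_comm, hm.braidTrace_eq (hτ a)] at h2
  exact h2.symm

/-- `S_{a, x × p} = M_{a,p} S_{a,x}` for a label `p` of order two. -/
theorem S_fuse (h : D.IsUBFC) {p a x y : L} {m : ℂ} (hp : D.FusesTo p p D.one)
    (hm : D.BraidsBy p m a) (hy : D.FusesTo x p y) : D.S a y = m * D.S a x := by
  choose τ hτ using h.exists_fusesTo hp
  rw [h.S_comm a x, S_eq_braidTrace, S_eq_braidTrace, h.braidTrace_fuse hy hm hτ]
  -- The weight shifted by $\tau$ is the original one, since $d_{c\times p}=d_c$.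
  simp only [h.qdim_fuse hp (hτ _)]
  ring

end IsUBFC

end Dimension

/-! ### Autoequivalences preserve the modular data -/

section Invariance

variable {L : Type*} [Fintype L] [DecidableEq L] {D : BraidedFusionData L}

namespace Autoequiv

/-- The unitary $U$ identifies the two splitting spaces, whose dimensions are again traces of
projections. -/
theorem N_perm (ρ : D.Autoequiv) (a b c : L) :
    D.N (ρ.perm a) (ρ.perm b) (ρ.perm c) = D.N a b c := by
  have key : ∀ a b c, (D.N a b c : ℂ) =
      trace (diagonal (fun i : Vertex D.N =>
        if i.a = a ∧ i.b = b then (if i.c = c then (1 : ℂ) else 0) else 0)) := by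
    intro a b c
    rw [trace_diagonal, sum_vertex D.N a b fun e => if e = c then 1 else 0]
    simp
  have e : (D.N a b c : ℂ) = D.N (ρ.perm a) (ρ.perm b) (ρ.perm c) := by
    rw [key a b, key (ρ.perm a)]
    calc _ = trace (diagonal (fun i : Vertex D.N =>
          if i.a = a ∧ i.b = b then (if i.c = c then (1 : ℂ) else 0) else 0) * (ρ.U * ρ.Uᴴ)) := by
            rw [unitary_mul ρ.U_unitary, Matrix.mul_one]
      _ = _ := by
        rw [← Matrix.mul_assoc, diagonal_mul_eq_mul_diagonal (A := ρ.U)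
          (h := fun i : Vertex D.N => if i.a = ρ.perm a ∧ i.b = ρ.perm b then
            (if i.c = ρ.perm c then (1 : ℂ) else 0) else 0),
          Matrix.mul_assoc, trace_mul_comm, Matrix.mul_assoc, unitary_mul' ρ.U_unitary,
          Matrix.mul_one]
        intro i j hij
        obtain ⟨h1, h2, h3⟩ := ρ.U_support i j hij
        simp only [h1, h2, h3, EmbeddingLike.apply_eq_iff_eq]
  exact_mod_cast e.symm

theorem qdim_perm (ρ : D.Autoequiv) (a : L) : D.qdim (ρ.perm a) = D.qdim a := by
  have e : D.fusionMatrix (ρ.perm a) =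
      Matrix.reindexAlgEquiv ℂ ℂ ρ.perm (D.fusionMatrix a) := by
    ext b c
    have := ρ.N_perm a (ρ.perm.symm b) (ρ.perm.symm c)
    simp only [Equiv.apply_symm_apply] at this
    simp [fusionMatrix, this]
  have e2 : spectralRadius ℂ (D.fusionMatrix (ρ.perm a)) = spectralRadius ℂ (D.fusionMatrix a) := by
    rw [e]
    simp only [spectralRadius, AlgEquiv.spectrum_eq]
  exact congrArg ENNReal.toReal e2

/-- For a linear $\rho$ the matrix $R^2$ is invariant under conjugation by $U$, and the weights
$d_c$ are invariant by `qdim_perm`. An antilinear $\rho$ would bring in complex conjugation. -/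
theorem S_perm (ρ : D.Autoequiv) (hσ : ρ.σ = 1) (a b : L) :
    D.S (ρ.perm a) (ρ.perm b) = D.S a b := by
  have hR : D.R = ρ.U * D.R * ρ.Uᴴ := by
    rw [← ρ.map_R, hσ]
    ext
    simp
  have hRR : D.R * D.R = ρ.U * (D.R * D.R) * ρ.Uᴴ := by
    calc D.R * D.R = (ρ.U * D.R * ρ.Uᴴ) * (ρ.U * D.R * ρ.Uᴴ) := by rw [← hR]
      _ = ρ.U * D.R * (ρ.Uᴴ * ρ.U) * D.R * ρ.Uᴴ := by simp only [Matrix.mul_assoc]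
      _ = _ := by rw [unitary_mul' ρ.U_unitary, Matrix.mul_one]; simp only [Matrix.mul_assoc]
  rw [S_eq_braidTrace, S_eq_braidTrace, braidTrace_eq_trace, braidTrace_eq_trace]
  have e : diagonal (fun i : Vertex D.N => if i.a = a ∧ i.b = b then (D.qdim i.c : ℂ) else 0) *
      ρ.U = ρ.U * diagonal (fun i : Vertex D.N =>
        if i.a = ρ.perm a ∧ i.b = ρ.perm b then (D.qdim i.c : ℂ) else 0) := by
    apply diagonal_mul_eq_mul_diagonal
    intro i j hij
    obtain ⟨h1, h2, h3⟩ := ρ.U_support i j hij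
    simp only [h1, h2, h3, EmbeddingLike.apply_eq_iff_eq, qdim_perm]
  congr 1
  symm
  conv_lhs => rw [hRR, Matrix.mul_assoc ρ.U, ← Matrix.mul_assoc _ ρ.U, e, Matrix.mul_assoc ρ.U,
    trace_mul_comm ρ.U, Matrix.mul_assoc, Matrix.mul_assoc (D.R * D.R), unitary_mul' ρ.U_unitary,
    Matrix.mul_one]

end Autoequiv

/-- A symmetry of `S` that fixes the labels of trivial braiding with `p` acts on every label as the
identity or as fusion with `p`. -/
theorem IsUMTC.eq_or_fusesTo (h : D.IsUMTC) {p : L} (hp : D.FusesTo p p D.one) {f : L → L}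
    (hS : ∀ a b, D.S (f a) (f b) = D.S a b) (hf : ∀ a ∈ D.even p, f a = a) (x : L) :
    f x = x ∨ D.FusesTo x p (f x) := by
  choose τ hτ using h.toIsUBFC.exists_fusesTo hp
  have hinj : Function.Injective D.S.mulVec := mulVec_injective_of_isUnit h.modular
  -- Summing over the $p$-orbit cancels the odd rows of $S$, on which nothing is known about $f$;
  -- the even rows agree because $f$ fixes their labels.
  have hv : (Pi.single x 1 + Pi.single (τ x) 1 : L → ℂ) =
      Pi.single (f x) 1 + Pi.single (τ (f x)) 1 := by
    apply hinj
    ext a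
    simp only [mulVec_add, mulVec_single_one, Pi.add_apply, col_apply]
    obtain ⟨m, hm⟩ := h.toIsUBFC.exists_braidsBy (hτ a)
    rw [h.toIsUBFC.S_fuse hp hm (hτ x), h.toIsUBFC.S_fuse hp hm (hτ (f x))]
    rcases mul_self_eq_one_iff.1 (h.toIsUBFC.braidsBy_sq hp hm) with rfl | rfl
    · have ha : a ∈ D.even p := by simpa [even] using hm
      have := hS a x
      rw [hf a ha] at this
      rw [this]
    · ring
  by_contra! hne
  -- At $f(x)$ the left side is $0$, while the right side is $1$, or $2$ if $f(x)\times p=f(x)$.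
  have e := congrFun hv (f x)
  have h2 : f x ≠ τ x := fun h2 => hne.2 (by rw [h2]; exact hτ x)
  rw [Pi.add_apply, Pi.add_apply, Pi.single_eq_of_ne hne.1, Pi.single_eq_of_ne h2,
    Pi.single_eq_same] at e
  by_cases h3 : f x = τ (f x)
  · rw [← h3, Pi.single_eq_same] at e
    norm_num at e
  · rw [Pi.single_eq_of_ne h3] at e
    norm_num at e

theorem IsVortex.S_fuse_eq_neg (h : D.IsUBFC) {p u v v' : L} (hp : D.FusesTo p p D.one)
    (hu : D.IsVortex p u) (hv : D.FusesTo v p v') : D.S u v' = -D.S u v := by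
  rw [h.S_fuse hp hu hv, neg_one_mul]

end Invariance

/-! ### Representatives of the kernel of restriction -/

section Restriction

variable {L : Type*} [Fintype L] [DecidableEq L] {D : BraidedFusionData L}

/-- A class in the kernel of the restriction has a linear representative that fixes the even
sector pointwise. -/
theorem exists_rep_of_mem_ker {ψ : L} (hD : D.IsSpinModular ψ) {ρ : AutLR D ψ}
    (hρ : ρ ∈ (restrictAutLR hD).ker) :
    ∃ r : D.Autoequiv, r.perm = AutLR.perm D ψ ρ ∧ r.σ = 1 ∧ ∀ a ∈ D.even ψ, r.perm a = a := by
  induction ρ using QuotientGroup.induction_on with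
  | H r =>
    have h1 : restrictRep hD r ∈ lrNatIso (D.evenPart hD) (evenFermion hD) :=
      (QuotientGroup.eq_one_iff _).1 hρ
    obtain ⟨hσ, hperm, -⟩ := h1
    refine ⟨r.1, rfl, hσ, fun a ha => ?_⟩
    exact congrArg Subtype.val (Equiv.congr_fun hperm ⟨a, ha⟩)

end Restriction

end BraidedFusionData

theorem mainTheorem4 {L : Type*} [Fintype L] [DecidableEq L] (D : BraidedFusionData L) (ψ : L)
    (hD : D.IsSpinModular ψ) (k : ℕ) (B : {x : L // D.IsVType ψ x} → Fin k)
    (hB : D.IsBlockDecomposition ψ B)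
    (ρ : BraidedFusionData.AutLR D ψ) (hρ : ρ ∈ (BraidedFusionData.restrictAutLR hD).ker) :
    ∃ q : {x : L // D.IsVortex ψ x} → Fin 2,
      (∀ x : {x : L // D.IsVortex ψ x}, D.FusesTo (x : L) (D.psiPow ψ (q x)) (BraidedFusionData.AutLR.perm D ψ ρ (x : L))) ∧
      (∃ qB : Fin k → Fin 2, ∀ (x : L) (hx : D.IsVType ψ x), q ⟨x, hx.1⟩ = qB (B ⟨x, hx⟩)) ∧
      (∀ (x : L) (hx : D.IsSigmaType ψ x), q ⟨x, hx.1⟩ = 0) := by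
  obtain ⟨r, hr, hσ, hfix⟩ := BraidedFusionData.exists_rep_of_mem_ker hD hρ
  rw [← hr]
  have hU : D.IsUBFC := hD.toIsUMTC.toIsUBFC
  have hp : D.FusesTo ψ ψ D.one := hD.fuse
  have hS := r.S_perm hσ
  have hor := hD.toIsUMTC.eq_or_fusesTo hp hS hfix
  -- When $x\times\psi=x$ both exponents describe the action; this choice gives $0$, as needed for
  -- $\sigma$-type vortices.
  let q : L → Fin 2 := fun x => if r.perm x = x then 0 else 1
  have hq0 : ∀ x, q x = 0 ↔ r.perm x = x := fun x => by simp [q]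
  have hne : ∀ u v, D.IsVortex ψ u → r.perm u = u → r.perm v ≠ v → D.S u v = 0 := by
    intro u v hu h1 h2
    have e1 := hu.S_fuse_eq_neg hU hp ((hor v).resolve_left h2)
    have e2 := hS u v
    rw [h1, e1] at e2
    linear_combination -e2 / 2
  have hdec : ∀ u v, D.IsVortex ψ u → D.IsVortex ψ v → q u ≠ q v → D.S u v = 0 := by
    intro u v hu hv huv
    by_cases h1 : r.perm u = u
    · exact hne u v hu h1 fun h2 => huv (by rw [(hq0 u).2 h1, (hq0 v).2 h2])
    · by_cases h2 : r.perm v = v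
      · rw [hU.S_comm]
        exact hne v u hv h2 h1
      · exact absurd (by simp [q, h1, h2]) huv
  refine ⟨fun x => q x, fun x => ?_, ?_, fun x hx => ?_⟩
  · by_cases h1 : r.perm (x : L) = x
    · change D.FusesTo x (D.psiPow ψ (q x)) _
      rw [(hq0 _).2 h1, h1]
      exact hU.fusesTo_one x
    · have h2 : q x ≠ 0 := fun h => h1 ((hq0 _).1 h)
      change D.FusesTo x (D.psiPow ψ (q x)) _
      rw [BraidedFusionData.psiPow, if_neg h2]
      exact (hor x).resolve_left h1
  · have hconst : ∀ x y : {x : L // D.IsVType ψ x}, B x = B y → q x = q y := by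
      intro x y hxy
      -- A level set of $q$ is decoupled from its complement, so it cannot split a block.
      refine (hB.indecomposable {z | q z = q x} ?_ x y hxy rfl).symm
      intro u hu v hv _
      have huv : q u ≠ q v := fun h => hv (h.symm.trans hu)
      exact ⟨hdec u v u.2.1 v.2.1 huv, hdec v u v.2.1 u.2.1 huv.symm⟩
    -- Blocks are non-empty, so the value on a block is read off at a chosen member.
    let g := Function.surjInv hB.surjective
    have hg : ∀ i, B (g i) = i := Function.surjInv_eq hB.surjective
    exact ⟨fun i => q (g i), fun x hx => hconst ⟨x, hx⟩ (g (B ⟨x, hx⟩)) (hg _).symm⟩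
  · refine (hq0 x).2 ?_
    rcases hor x with h1 | h1
    · exact h1
    · exact h1.unique hx.2
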